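/- Let $K=\mathbb F_q((x))$ with $|z|=q^{-m}$ for $z=\sum_{i\ge m}\zeta_i x^i$, $\zeta_m\ne 0$, and let $\overline K_c$ be the completion of an algebraic closure of $K$. For $n\ge 0$ let $\mathcal F_{n+1}$ be the set of germs at the origin of functions $$f(s,t_1,\dots,t_n)=\sum_{k_1,\dots,k_n\ge 0}\ \sum_{0\le m\le \min(k_1,\dots,k_n)} a_{m,k_1,\dots,k_n}\, s^{q^m}t_1^{q^{k_1}}\cdots t_n^{q^{k_n}},\qquad a_{m,k_1,\dots,k_n}\in\overline K_c,$$ where the series converges near the origin (for $n=0$ there is no bound on $m$). Let $\mathfrak A_{n+1}$ be the ring of operators on $\mathcal F_{n+1}$ generated by multiplications by scalars from $\overline K_c$ and by $\tau u=u^q$, $d_s=\tau^{-1}\Delta_s$ and $\Delta_1,\dots,\Delta_n$, where $\Delta_s u=u(xs,t_1,\dots,t_n)-xu$, $\Delta_j u=u(s,t_1,\dots,xt_j,\dots,t_n)-xu$, and $\tau^{-1}$ is the $q$-th root of the values. Filter $\mathfrak A_{n+1}$ by the $\overline K_c$-spans $\Gamma_\nu$ of the operators $\tau^l d_s^\mu\Delta_1^{i_1}\cdots\Delta_n^{i_n}$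 with $l+\mu+i_1+\dots+i_n\le\nu$. For a left $\mathfrak A_{n+1}$-module $M$, a filtration is an increasing exhaustive sequence of finite-dimensional $\overline K_c$-subspaces $\mathfrak M_j$ with $\Gamma_\nu\mathfrak M_j\subset\mathfrak M_{\nu+j}$; it is good if $\bigoplus_j\mathfrak M_j/\mathfrak M_{j-1}$ is finitely generated over $\bigoplus_\nu\Gamma_\nu/\Gamma_{\nu-1}$. The (Gelfand–Kirillov) dimension $d(M)$ is the degree of the polynomial $\chi\in\mathbb Q[t]$ with $\dim\mathfrak M_s=\chi(s)$ for all large $s$, for a good filtration; it does not depend on the choice of the good filtration. Call $f\in\mathcal F_{n+1}$ non-sparse if there is a sequence $m_l\to\infty$ of non-negative integers such that for every $l$ there are $n$ integer sequences $(k_1^{(i)})_i,\dots,(k_n^{(i)})_i$, with all terms $\ge m_l$ and each tending to infinity as $i\to\infty$, such that $a_{m_l,k_1^{(i_1)},\dots,k_n^{(i_n)}}\ne 0$ for all indices $i_1,\dots,i_n$. **Theorem.** Let $f\in\mathcal F_{n+1}$ be non-sparse and let $M_f=\mathfrak A_{n+1}f$. Then $M_f$ has a dimension, and $d(M_f)\ge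 n+1$. If, in addition, $\varphi(f)=0$ for some $0\ne\varphi\in\mathfrak A_{n+1}$, then $d(M_f)=n+1$, that is, $f$ is quasi-holonomic. -/

import Mathlib

open Filter Topology
open scoped NNReal WithZero

noncomputable section

namespace Carlitz

section Field

variable (Fq : Type*) [Field Fq] [Fintype Fq]

theorem one_lt_card_nnreal : (1 : ℝ≥0) < (Fintype.card Fq : ℝ≥0) := by
  exact_mod_cast Fintype.one_lt_card

/-- The order valuation of `K = 𝔽_q((x))` takes the real values `q ^ (-m)`, with `q = #𝔽_q`. -/
instance rankOne :
    Valuation.RankOne (Valued.v : Valuation (LaurentSeries Fq) ℤᵐ⁰) where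
  hom' := (WithZeroMulInt.toNNReal (one_lt_card_nnreal Fq).ne_zero).comp
    MonoidWithZeroHom.ValueGroup₀.embedding
  strictMono' := (WithZeroMulInt.toNNReal_strictMono (one_lt_card_nnreal Fq)).comp
    MonoidWithZeroHom.ValueGroup₀.embedding_strictMono
  exists_val_nontrivial := by
    obtain ⟨x, hx⟩ := LaurentSeries.valuation_surjective Fq (WithZero.exp 1)
    refine ⟨x, ?_, ?_⟩
    · rw [hx]; exact WithZero.exp_ne_zero
    · rw [hx]; decide

/-- The absolute value of `K`, with `|z| = q ^ (-m)` if `z = ∑_{i ≥ m} ζ_i x ^ i`, `ζ_m ≠ 0`. -/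
instance laurentNormedField : NontriviallyNormedField (LaurentSeries Fq) :=
  Valued.toNontriviallyNormedField (LaurentSeries Fq) ℤᵐ⁰

instance laurentUltrametric : IsUltrametricDist (LaurentSeries Fq) :=
  Valued.instIsUltrametricDist _ _

theorem norm_single (m : ℤ) : ‖(HahnSeries.single m (1 : Fq) : LaurentSeries Fq)‖ =
    (Fintype.card Fq : ℝ) ^ (-m) := by
  change ((WithZeroMulInt.toNNReal (one_lt_card_nnreal Fq).ne_zero
    (MonoidWithZeroHom.ValueGroup₀.embedding (Valued.v.restrict
      (HahnSeries.single m (1 : Fq) : LaurentSeries Fq))) : ℝ≥0) : ℝ) = _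
  rw [Valuation.embedding_restrict, LaurentSeries.valuation_single_zpow,
    WithZeroMulInt.toNNReal_neg_apply _ WithZero.exp_ne_zero]
  have h : Multiplicative.toAdd (WithZero.unzero (WithZero.exp_ne_zero (a := -m))) = -m := rfl
  rw [h]
  simp

/-- An algebraic closure of `K`. -/
abbrev KBar : Type _ := AlgebraicClosure (LaurentSeries Fq)

/-- The unique extension of the absolute value of `K` to the algebraic closure. -/
instance kbarNormedField : NontriviallyNormedField (KBar Fq) :=
  spectralNorm.nontriviallyNormedField (LaurentSeries Fq) (KBar Fq)

instance kbarNormedAlgebra : NormedAlgebra (LaurentSeries Fq) (KBar Fq) :=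
  spectralNorm.normedAlgebra (LaurentSeries Fq) (KBar Fq)

/-- `K̄_c`: the completion of the algebraic closure of `K`. -/
def Kc : Type _ := UniformSpace.Completion (KBar Fq)

instance kcNormedField : NormedField (Kc Fq) :=
  inferInstanceAs (NormedField (UniformSpace.Completion (KBar Fq)))

instance kcCompleteSpace : CompleteSpace (Kc Fq) :=
  inferInstanceAs (CompleteSpace (UniformSpace.Completion (KBar Fq)))

instance kcNormedAlgebra : NormedAlgebra (KBar Fq) (Kc Fq) :=
  inferInstanceAs (NormedAlgebra (KBar Fq) (UniformSpace.Completion (KBar Fq)))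

/-- The element `x` of `K`, in `K̄_c`. -/
def indet : Kc Fq :=
  algebraMap (KBar Fq) (Kc Fq) (algebraMap (LaurentSeries Fq) (KBar Fq) (HahnSeries.single 1 1))

theorem norm_indet : ‖indet Fq‖ = (Fintype.card Fq : ℝ)⁻¹ := by
  rw [indet, norm_algebraMap', norm_algebraMap', norm_single, zpow_neg_one]

theorem exists_charP : ∃ (p k : ℕ), Nat.Prime p ∧ CharP (Kc Fq) p ∧ Fintype.card Fq = p ^ k := by
  obtain ⟨p, hp⟩ := CharP.exists Fq
  obtain ⟨k, hpp, hk⟩ := FiniteField.card Fq p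
  refine ⟨p, k, hpp, ?_, hk⟩
  have h1 : CharP (LaurentSeries Fq) p :=
    charP_of_injective_ringHom (HahnSeries.C_injective (Γ := ℤ) (R := Fq)) p
  have h2 : CharP (KBar Fq) p := charP_of_injective_algebraMap
    (algebraMap (LaurentSeries Fq) (KBar Fq)).injective p
  exact charP_of_injective_algebraMap (algebraMap (KBar Fq) (Kc Fq)).injective p

/-- The ring endomorphism `c ↦ c ^ q` of `K̄_c`. -/
def frobHom : Kc Fq →+* Kc Fq where
  toFun c := c ^ Fintype.card Fq
  map_one' := one_pow _
  map_mul' a b := mul_pow a b _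
  map_zero' := zero_pow Fintype.card_ne_zero
  map_add' a b := by
    obtain ⟨p, k, hp, hc, hq⟩ := exists_charP Fq
    have := Fact.mk hp
    rw [hq, add_pow_char_pow]

theorem norm_frobHom (c : Kc Fq) : ‖frobHom Fq c‖ = ‖c‖ ^ Fintype.card Fq := norm_pow _ _

theorem frobHom_continuous : Continuous (frobHom Fq) := continuous_pow _

theorem frobHom_isUniformInducing : IsUniformInducing (frobHom Fq) := by
  rw [Metric.isUniformInducing_iff]
  refine ⟨uniformContinuous_addMonoidHom_of_continuous (frobHom_continuous Fq), fun δ hδ =>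
    ⟨δ ^ Fintype.card Fq, by positivity, fun {a b} h => ?_⟩⟩
  rw [dist_eq_norm, ← map_sub, norm_frobHom] at h
  rw [dist_eq_norm]
  exact lt_of_pow_lt_pow_left₀ _ hδ.le h

theorem frobHom_surjective : Function.Surjective (frobHom Fq) := by
  have hcl : IsClosed (Set.range (frobHom Fq)) :=
    (frobHom_isUniformInducing Fq).isComplete_range.isClosed
  have hsub : Set.range (algebraMap (KBar Fq) (Kc Fq)) ⊆ Set.range (frobHom Fq) := by
    rintro _ ⟨c, rfl⟩
    obtain ⟨b, hb⟩ := IsAlgClosed.exists_pow_nat_eq c (Fintype.card_pos (α := Fq))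
    exact ⟨algebraMap _ _ b, by rw [← hb, map_pow]; rfl⟩
  have hd : DenseRange (algebraMap (KBar Fq) (Kc Fq)) := UniformSpace.Completion.denseRange_coe
  intro c
  have : c ∈ closure (Set.range (algebraMap (KBar Fq) (Kc Fq))) := hd c
  exact closure_minimal hsub hcl this

/-- The automorphism `c ↦ c ^ q` of `K̄_c`; its inverse is the `q`-th root. -/
def frob : Kc Fq ≃+* Kc Fq :=
  RingEquiv.ofBijective (frobHom Fq) ⟨(frobHom Fq).injective, frobHom_surjective Fq⟩

theorem frob_apply (c : Kc Fq) : frob Fq c = c ^ Fintype.card Fq := rfl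

theorem frob_symm_pow (c : Kc Fq) : (frob Fq).symm (c ^ Fintype.card Fq) = c :=
  (frob Fq).symm_apply_apply c

theorem frob_continuous : Continuous (frob Fq) := frobHom_continuous Fq

theorem frob_symm_continuous : Continuous (frob Fq).symm := by
  rw [(frobHom_isUniformInducing Fq).isInducing.continuous_iff]
  convert continuous_id
  ext c
  exact (frob Fq).apply_symm_apply c

end Field

section Functions

variable (Fq : Type*) [Field Fq] [Fintype Fq] (n : ℕ)

/-- Germs at the origin of `K̄_c`-valued functions of `z = (s, (t_1, …, t_n))`. -/
abbrev FunGerm : Type _ := Germ (𝓝 (0 : Kc Fq × (Fin n → Kc Fq))) (Kc Fq)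

variable {n}

/-- The monomial `s ^ (q ^ m) * ∏ j, t_j ^ (q ^ k_j)`, for `e = (m, k)`. -/
def monomial (z : Kc Fq × (Fin n → Kc Fq)) (e : ℕ × (Fin n → ℕ)) : Kc Fq :=
  z.1 ^ Fintype.card Fq ^ e.1 * ∏ j, z.2 j ^ Fintype.card Fq ^ e.2 j

variable {Fq}

/-- `f` is the germ of `∑ a_{m,k} s ^ (q ^ m) ∏ j, t_j ^ (q ^ k_j)`, where the sum is over all `m, k`
with `m ≤ min (k_1, …, k_n)`, and converges near the origin. -/
structure IsExpansion (a : ℕ × (Fin n → ℕ) → Kc Fq) (f : FunGerm Fq n) : Prop where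
  le_of_ne_zero : ∀ e, a e ≠ 0 → ∀ j, e.1 ≤ e.2 j
  hasSum : ∃ u : Kc Fq × (Fin n → Kc Fq) → Kc Fq, f = (u : FunGerm Fq n) ∧
    ∀ᶠ z in 𝓝 0, HasSum (fun e => a e * monomial Fq z e) (u z)

variable (Fq n)

/-- The space `F_{n+1}` of all germs having such an expansion. -/
def CarlitzFun : Submodule (Kc Fq) (FunGerm Fq n) where
  carrier := {f | ∃ a, IsExpansion a f}
  zero_mem' := ⟨0, by simp, fun _ => 0, rfl, by simp⟩
  add_mem' := by
    rintro _ _ ⟨a, ha, u, rfl, hu⟩ ⟨b, hb, v, rfl, hv⟩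
    refine ⟨a + b, fun e he j => ?_, u + v, rfl, ?_⟩
    · by_contra h
      have h1 : a e = 0 := by_contra fun h' => h (ha e h' j)
      have h2 : b e = 0 := by_contra fun h' => h (hb e h' j)
      exact he (by simp [h1, h2])
    · filter_upwards [hu, hv] with z h1 h2
      simpa [add_mul] using h1.add h2
  smul_mem' := by
    rintro c _ ⟨a, ha, u, rfl, hu⟩
    refine ⟨c • a, fun e he j => ha e (fun h => he (by simp [h])) j, c • u, rfl, ?_⟩
    filter_upwards [hu] with z h1
    simpa [mul_assoc] using h1.mul_left c

variable {n}

/-- `(s, t) ↦ (x s, t)`. -/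
def scaleS (z : Kc Fq × (Fin n → Kc Fq)) : Kc Fq × (Fin n → Kc Fq) := (indet Fq * z.1, z.2)

/-- `(s, t) ↦ (s, t_1, …, x t_j, …, t_n)`. -/
def scaleT (j : Fin n) (z : Kc Fq × (Fin n → Kc Fq)) : Kc Fq × (Fin n → Kc Fq) :=
  (z.1, Function.update z.2 j (indet Fq * z.2 j))

theorem tendsto_scaleS : Tendsto (scaleS Fq (n := n)) (𝓝 0) (𝓝 0) := by
  have : Continuous (scaleS Fq (n := n)) := by unfold scaleS; fun_prop
  simpa [scaleS, Prod.zero_eq_mk] using this.tendsto 0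

theorem tendsto_scaleT (j : Fin n) : Tendsto (scaleT Fq j) (𝓝 0) (𝓝 0) := by
  have : Continuous (scaleT Fq j) := by
    unfold scaleT
    exact continuous_fst.prodMk (continuous_snd.update j (by fun_prop))
  simpa [scaleT, Prod.zero_eq_mk] using this.tendsto 0

variable (n)

/-- `τ u = u ^ q`. -/
def germTau : FunGerm Fq n →+ FunGerm Fq n where
  toFun f := f.map fun c => c ^ Fintype.card Fq
  map_zero' := by
    change ((fun _ => frob Fq 0 : Kc Fq × (Fin n → Kc Fq) → Kc Fq) : FunGerm Fq n) = _
    simp only [map_zero]; rfl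
  map_add' f g := by
    induction f, g using Germ.inductionOn₂ with
    | h u v => exact congrArg _ (funext fun z => map_add (frob Fq) (u z) (v z))

/-- `u(s, t) ↦ u(x s, t)`. -/
def germScaleS : FunGerm Fq n →+ FunGerm Fq n where
  toFun f := f.compTendsto (scaleS Fq) (tendsto_scaleS Fq)
  map_zero' := rfl
  map_add' f g := by
    induction f, g using Germ.inductionOn₂ with
    | h u v => rfl

/-- `u(s, t) ↦ u(s, t_1, …, x t_j, …, t_n)`. -/
def germScaleT (j : Fin n) : FunGerm Fq n →+ FunGerm Fq n where
  toFun f := f.compTendsto (scaleT Fq j) (tendsto_scaleT Fq j)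
  map_zero' := rfl
  map_add' f g := by
    induction f, g using Germ.inductionOn₂ with
    | h u v => rfl

/-- `τ⁻¹`: the `q`-th root of the values. -/
def germRoot : FunGerm Fq n →+ FunGerm Fq n where
  toFun f := f.map (frob Fq).symm
  map_zero' := by
    change ((fun _ => (frob Fq).symm 0 : Kc Fq × (Fin n → Kc Fq) → Kc Fq) : FunGerm Fq n) = _
    simp only [map_zero]; rfl
  map_add' f g := by
    induction f, g using Germ.inductionOn₂ with
    | h u v => exact congrArg _ (funext fun z => map_add (frob Fq).symm (u z) (v z))

/-- The Carlitz derivative in `s`: `d_s = τ⁻¹ Δ_s`, where `Δ_s u(s, t) = u(x s, t) - x u(s, t)`. -/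
def germD : FunGerm Fq n →+ FunGerm Fq n where
  toFun f := germRoot Fq n (germScaleS Fq n f - indet Fq • f)
  map_zero' := by simp
  map_add' f g := by
    rw [← map_add]
    congr 1
    rw [map_add, smul_add]
    abel

/-- `Δ_j u(s, t) = u(s, t_1, …, x t_j, …, t_n) - x u(s, t)`. -/
def germDelta (j : Fin n) : FunGerm Fq n →+ FunGerm Fq n where
  toFun f := germScaleT Fq n j f - indet Fq • f
  map_zero' := by simp
  map_add' f g := by
    rw [map_add, smul_add]; abel

variable {n}

theorem monomial_scaleS (z : Kc Fq × (Fin n → Kc Fq)) (e : ℕ × (Fin n → ℕ)) :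
    monomial Fq (scaleS Fq z) e = indet Fq ^ Fintype.card Fq ^ e.1 * monomial Fq z e := by
  simp only [monomial, scaleS, mul_pow, mul_assoc]

theorem monomial_scaleT (j : Fin n) (z : Kc Fq × (Fin n → Kc Fq)) (e : ℕ × (Fin n → ℕ)) :
    monomial Fq (scaleT Fq j z) e = indet Fq ^ Fintype.card Fq ^ e.2 j * monomial Fq z e := by
  have h : ∀ i, (scaleT Fq j z).2 i ^ Fintype.card Fq ^ e.2 i =
      (if i = j then indet Fq ^ Fintype.card Fq ^ e.2 j else 1) *
        z.2 i ^ Fintype.card Fq ^ e.2 i := by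
    intro i
    by_cases hi : i = j
    · subst hi; simp [scaleT, mul_pow]
    · simp [scaleT, hi]
  rw [monomial, Finset.prod_congr rfl fun i _ => h i, Finset.prod_mul_distrib]
  simp [monomial, scaleT]
  ring

/-- Raises all exponents by one. -/
def shift (e : ℕ × (Fin n → ℕ)) : ℕ × (Fin n → ℕ) := (e.1 + 1, fun j => e.2 j + 1)

theorem shift_injective : Function.Injective (shift (n := n)) := by
  rintro ⟨m, k⟩ ⟨m', k'⟩ h
  simp only [shift, Prod.mk.injEq] at h
  refine Prod.ext (by simpa using h.1) (funext fun j => ?_)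
  simpa using congrFun h.2 j

theorem monomial_shift (z : Kc Fq × (Fin n → Kc Fq)) (e : ℕ × (Fin n → ℕ)) :
    monomial Fq z (shift e) = frob Fq (monomial Fq z e) := by
  simp only [monomial, shift, frob_apply, mul_pow, ← Finset.prod_pow, ← pow_mul, pow_succ]

theorem germTau_mem {f : FunGerm Fq n} (hf : f ∈ CarlitzFun Fq n) :
    germTau Fq n f ∈ CarlitzFun Fq n := by
  obtain ⟨a, ha, u, rfl, hu⟩ := hf
  refine ⟨Function.extend shift (fun e => frob Fq (a e)) 0, fun e he j => ?_,
    fun z => frob Fq (u z), rfl, ?_⟩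
  · by_cases h : ∃ e', shift e' = e
    · obtain ⟨e', rfl⟩ := h
      rw [shift_injective.extend_apply] at he
      have := ha e' (fun h => he (by simp [h])) j
      simpa [shift] using this
    · exact absurd (Function.extend_apply' _ _ _ h) he
  · filter_upwards [hu] with z hz
    have h1 := hz.map (frob Fq) (frob_continuous Fq)
    rw [← shift_injective.hasSum_iff (fun e he => ?_)]
    · refine (congrArg (fun g => HasSum g _) (funext fun e => ?_)).mp h1
      rw [Function.comp_apply, Function.comp_apply, shift_injective.extend_apply, monomial_shift,
        map_mul]
    · rw [Function.extend_apply' _ _ _ (fun h => he h)]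
      simp

theorem germDelta_mem (j : Fin n) {f : FunGerm Fq n} (hf : f ∈ CarlitzFun Fq n) :
    germDelta Fq n j f ∈ CarlitzFun Fq n := by
  obtain ⟨a, ha, u, rfl, hu⟩ := hf
  refine ⟨fun e => (indet Fq ^ Fintype.card Fq ^ e.2 j - indet Fq) * a e,
    fun e he => ha e (fun h => he (by simp [h])), fun z => u (scaleT Fq j z) - indet Fq * u z, rfl, ?_⟩
  filter_upwards [hu, (tendsto_scaleT Fq j).eventually hu] with z h1 h2
  have h3 := h2.sub (h1.mul_left (indet Fq))
  have h4 : (fun e => a e * monomial Fq (scaleT Fq j z) e - indet Fq * (a e * monomial Fq z e)) =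
      fun e => (indet Fq ^ Fintype.card Fq ^ e.2 j - indet Fq) * a e * monomial Fq z e := by
    funext e
    rw [monomial_scaleT]
    ring
  rwa [h4] at h3

theorem germD_mem {f : FunGerm Fq n} (hf : f ∈ CarlitzFun Fq n) :
    germD Fq n f ∈ CarlitzFun Fq n := by
  obtain ⟨a, ha, u, rfl, hu⟩ := hf
  refine ⟨fun e => (frob Fq).symm ((indet Fq ^ Fintype.card Fq ^ (e.1 + 1) - indet Fq) * a (shift e)),
    fun e he j => ?_, fun z => (frob Fq).symm (u (scaleS Fq z) - indet Fq * u z), rfl, ?_⟩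
  · have := ha (shift e) (fun h => he (by simp [h])) j
    simpa [shift] using this
  · filter_upwards [hu, (tendsto_scaleS Fq).eventually hu] with z h1 h2
    have h3 := h2.sub (h1.mul_left (indet Fq))
    have h4 : (fun e => a e * monomial Fq (scaleS Fq z) e - indet Fq * (a e * monomial Fq z e)) =
        fun e => (indet Fq ^ Fintype.card Fq ^ e.1 - indet Fq) * a e * monomial Fq z e := by
      funext e
      rw [monomial_scaleS]
      ring
    rw [h4] at h3
    replace h3 := h3.map (frob Fq).symm (frob_symm_continuous Fq)
    rw [← shift_injective.hasSum_iff (fun e he => ?_)] at h3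
    · refine (congrArg (fun g => HasSum g _) (funext fun e => ?_)).mp h3
      simp only [Function.comp_apply, monomial_shift]
      rw [map_mul _ _ (frob Fq _), RingEquiv.symm_apply_apply]
      rfl
    · have h0 : a e = 0 ∨ e.1 = 0 := by
        by_contra! h
        refine he ⟨(e.1 - 1, fun j => e.2 j - 1), ?_⟩
        have := ha e h.1
        refine Prod.ext ?_ (funext fun j => ?_)
        · simp only [shift]; omega
        · have := this j
          simp only [shift]; omega
      rcases h0 with h0 | h0 <;> simp [h0]

end Functions

section Ring

variable (Fq : Type*) [Field Fq] [Fintype Fq] (n : ℕ)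

/-- `τ` on `F_{n+1}`. -/
def opTau : AddMonoid.End (CarlitzFun Fq n) :=
  ((germTau Fq n).comp (CarlitzFun Fq n).subtype.toAddMonoidHom).codRestrict (CarlitzFun Fq n)
    fun f => germTau_mem Fq f.2

/-- `d_s` on `F_{n+1}`. -/
def opD : AddMonoid.End (CarlitzFun Fq n) :=
  ((germD Fq n).comp (CarlitzFun Fq n).subtype.toAddMonoidHom).codRestrict (CarlitzFun Fq n)
    fun f => germD_mem Fq f.2

/-- `Δ_j` on `F_{n+1}`. -/
def opDelta (j : Fin n) : AddMonoid.End (CarlitzFun Fq n) :=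
  ((germDelta Fq n j).comp (CarlitzFun Fq n).subtype.toAddMonoidHom).codRestrict (CarlitzFun Fq n)
    fun f => germDelta_mem Fq j f.2

/-- Multiplication by scalars of `K̄_c` on `F_{n+1}`. -/
def opScalar : Kc Fq →+* AddMonoid.End (CarlitzFun Fq n) :=
  Module.toAddMonoidEnd (Kc Fq) (CarlitzFun Fq n)

/-- The ring of additive operators on `F_{n+1}` generated by `τ`, `d_s`, `Δ_1, …, Δ_n` and the
scalars. -/
def carlitzSubring : Subring (AddMonoid.End (CarlitzFun Fq n)) :=
  Subring.closure ({opTau Fq n, opD Fq n} ∪ Set.range (opDelta Fq n) ∪ Set.range (opScalar Fq n))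

/-- The Carlitz ring `𝔄_{n+1}`. -/
def CarlitzRing : Type _ := carlitzSubring Fq n

instance : Ring (CarlitzRing Fq n) := inferInstanceAs (Ring (carlitzSubring Fq n))

namespace CarlitzRing

def tau : CarlitzRing Fq n :=
  ⟨opTau Fq n, Subring.subset_closure (Or.inl (Or.inl (Or.inl rfl)))⟩

def dS : CarlitzRing Fq n :=
  ⟨opD Fq n, Subring.subset_closure (Or.inl (Or.inl (Or.inr rfl)))⟩

def delta (j : Fin n) : CarlitzRing Fq n :=
  ⟨opDelta Fq n j, Subring.subset_closure (Or.inl (Or.inr ⟨j, rfl⟩))⟩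

def scalar : Kc Fq →+* CarlitzRing Fq n :=
  (opScalar Fq n).codRestrict (carlitzSubring Fq n)
    fun c => Subring.subset_closure (Or.inr ⟨c, rfl⟩)

/-- `𝔄_{n+1}` as a `K̄_c`-vector space, by left multiplication with scalars. -/
instance : Module (Kc Fq) (CarlitzRing Fq n) := Module.compHom _ (scalar Fq n)

/-- `F_{n+1}` as a left `𝔄_{n+1}`-module: operators act by application. -/
instance : Module (CarlitzRing Fq n) (CarlitzFun Fq n) :=
  Module.compHom _ (carlitzSubring Fq n).subtype

instance : IsScalarTower (Kc Fq) (CarlitzRing Fq n) (CarlitzFun Fq n) where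
  smul_assoc _ _ _ := rfl

/-- The filtration `Γ_ν` of `𝔄_{n+1}`: all combinations over `K̄_c` of the
`τ ^ l d_s ^ μ Δ_1 ^ i_1 ⋯ Δ_n ^ i_n` with `l + μ + i_1 + ⋯ + i_n ≤ ν`. -/
def Gamma (ν : ℕ) : Submodule (Kc Fq) (CarlitzRing Fq n) :=
  Submodule.span (Kc Fq) {a | ∃ (l μ : ℕ) (i : Fin n → ℕ), l + μ + ∑ j, i j ≤ ν ∧
    a = tau Fq n ^ l * dS Fq n ^ μ * (List.ofFn fun j => delta Fq n j ^ i j).prod}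

end CarlitzRing

end Ring

section Filtered

variable (Fq : Type*) [Field Fq] [Fintype Fq] (n : ℕ)
  (M : Type*) [AddCommGroup M] [Module (CarlitzRing Fq n) M] [Module (Kc Fq) M]
  [IsScalarTower (Kc Fq) (CarlitzRing Fq n) M]

/-- A filtration of a left `𝔄_{n+1}`-module by finite-dimensional `K̄_c`-subspaces. -/
structure ModFiltration where
  part : ℕ → Submodule (Kc Fq) M
  mono : Monotone part
  exhaustive : ∀ v, ∃ j, v ∈ part j
  smul_mem : ∀ (ν j : ℕ) (a : CarlitzRing Fq n) (v : M),
    a ∈ CarlitzRing.Gamma Fq n ν → v ∈ part j → a • v ∈ part (ν + j)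
  finite : ∀ j, FiniteDimensional (Kc Fq) (part j)

variable {Fq n M}

/-- The filtration is good: `gr M = ⨁ 𝔐_j / 𝔐_{j-1}` is finitely generated over
`gr 𝔄 = ⨁ Γ_ν / Γ_{ν-1}`, that is, generated by the classes in `𝔐_{k_i} / 𝔐_{k_i - 1}` of
finitely many elements `g_i ∈ 𝔐_{k_i}`. In degree `j` this means
`𝔐_j = 𝔐_{j-1} + ∑_{k_i ≤ j} Γ_{j - k_i} g_i`. -/
def ModFiltration.IsGood (F : ModFiltration Fq n M) : Prop :=
  ∃ (r : ℕ) (k : Fin r → ℕ) (g : Fin r → M), (∀ i, g i ∈ F.part (k i)) ∧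
    ∀ j, F.part j ≤ (⨆ j' < j, F.part j') ⊔
      Submodule.span (Kc Fq) {v | ∃ i, k i ≤ j ∧ ∃ a ∈ CarlitzRing.Gamma Fq n (j - k i), v = a • g i}

/-- `χ` is the Hilbert polynomial of the filtration: `dim 𝔐_s = χ(s)` for all large `s`. -/
def ModFiltration.IsHilbertPolynomial (F : ModFiltration Fq n M) (χ : Polynomial ℚ) : Prop :=
  ∃ N : ℕ, ∀ s ≥ N, (Module.finrank (Kc Fq) (F.part s) : ℚ) = χ.eval (s : ℚ)

variable (Fq n M)

/-- `d(M) = d`: there is a good filtration of `M` with a Hilbert polynomial of degree `d`, and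
`d` does not depend on the choice of the good filtration. -/
def HasGKDim (d : ℕ) : Prop :=
  (∃ F : ModFiltration Fq n M, F.IsGood ∧ ∃ χ, F.IsHilbertPolynomial χ ∧ χ.degree = d) ∧
  ∀ F : ModFiltration Fq n M, F.IsGood → ∀ χ, F.IsHilbertPolynomial χ → χ.degree = d

end Filtered

section Main
variable {Fq : Type*} [Field Fq] [Fintype Fq] {n : ℕ}

/-- Non-sparse germs: there are `m_l → ∞` such that for each `l` there are `n` sequences
`(k_ν^(i))_i`, with terms at least `m_l` and tending to infinity, such that
`a_{m_l, k_1^(i_1), …, k_n^(i_n)} ≠ 0` for all choices of indices `i_1, …, i_n`. -/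
def NonSparse (f : CarlitzFun Fq n) : Prop :=
  ∃ a, IsExpansion a (f : FunGerm Fq n) ∧
    ∃ m : ℕ → ℕ, Tendsto m atTop atTop ∧
      ∀ l, ∃ k : Fin n → ℕ → ℕ, (∀ ν i, m l ≤ k ν i) ∧ (∀ ν, Tendsto (k ν) atTop atTop) ∧
        ∀ i : Fin n → ℕ, a (m l, fun ν => k ν (i ν)) ≠ 0

/-- `M_f = 𝔄_{n+1} f`. -/
abbrev cyclicModule (f : CarlitzFun Fq n) : Submodule (CarlitzRing Fq n) (CarlitzFun Fq n) :=
  Submodule.span (CarlitzRing Fq n) {f}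

/-- `f` is quasi-holonomic: `d(M_f) = n + 1`. -/
def IsQuasiHolonomic (f : CarlitzFun Fq n) : Prop := HasGKDim Fq n (cyclicModule f) (n + 1)

end Main
end Carlitz

end

/-! The generators `τ, d_s, Δ_1, …, Δ_n` are semilinear over the scalars, and each commutator of two
of them is a combination of words of length at most one. Up to lower order the ring therefore
behaves like a twisted polynomial ring in `n + 2` variables, and a Gröbner-basis argument applies to
`M_f`. Call an exponent `α` normal if `x ^ α f` is not a combination of the `x ^ β f` with `β`
smaller in the degree-lexicographic order. The normal exponents form a lower set of `ℕ ^ (n + 2)`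
(`isLowerSet_normalExponents`), and `dim Γ_ν f` is the number of them of total degree at most `ν`
(`finrank_map_wordSpan`). By Dickson's lemma this number is eventually polynomial in `ν`
(`eventuallyPolynomial_degCount`). Two good filtrations contain each other up to a shift of the
index, so the degree is an invariant of the module.

Lower bound: a suitable power `d_s ^ μ` carries a level `s ^ (q ^ m)` on which `f` is non-sparse to
the lowest level `s`, and leaves nonzero coefficients on an infinite grid. `Δ_j` acts on
coefficients as multiplication by `x ^ (q ^ k_j) - x`, and `τ` raises the level. A relation between
the `τ ^ l Δ ^ i d_s ^ μ f` thus gives, at its lowest level, a polynomial vanishing on a product of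
infinite sets. Hence these elements are independent (`linearIndependent_tau_delta`), and they have
`n + 1` free exponents.

Upper bound: if all exponents were normal, the `x ^ α f` would be independent and no `φ ≠ 0` could
kill `f`. So some `α` is not normal, the normal exponents avoid the whole orthant above `α`, and
their count is `O(ν ^ (n + 1))`. -/

open Filter Topology

noncomputable section

namespace Carlitz

/-! ### Eventually polynomial functions and comparison of degrees. -/

section EventuallyPolynomial

/-- `h` agrees with a rational polynomial at all large arguments. -/
def EventuallyPolynomial (h : ℕ → ℕ) : Prop :=
  ∃ χ : Polynomial ℚ, ∃ N : ℕ, ∀ s ≥ N, (h s : ℚ) = χ.eval (s : ℚ)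

/-- Bernoulli polynomials are antidifferences of powers: `B_{k+1}(1 + x) - B_{k+1}(x) = (k + 1) x ^
k`. -/
theorem exists_antidifference (P : Polynomial ℚ) :
    ∃ Q : Polynomial ℚ, ∀ x, Q.eval (1 + x) = Q.eval x + P.eval x := by
  induction P using Polynomial.induction_on' with
  | add p q hp hq =>
    obtain ⟨P, hP⟩ := hp
    obtain ⟨Q, hQ⟩ := hq
    refine ⟨P + Q, fun x => ?_⟩
    simp only [Polynomial.eval_add, hP, hQ]
    ring
  | monomial k c =>
    refine ⟨Polynomial.C (c / (k + 1)) * Polynomial.bernoulli (k + 1), fun x => ?_⟩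
    have : (k + 1 : ℚ) ≠ 0 := by positivity
    simp only [Polynomial.eval_mul, Polynomial.eval_C, Polynomial.bernoulli_eval_one_add,
      Polynomial.eval_monomial]
    push_cast
    field_simp

theorem EventuallyPolynomial.of_step {h g : ℕ → ℕ} (hg : EventuallyPolynomial g)
    (hh : ∀ s, h (s + 1) = g (s + 1) + h s) : EventuallyPolynomial h := by
  obtain ⟨P, N, hP⟩ := hg
  obtain ⟨Q, hQ⟩ := exists_antidifference (P.comp (Polynomial.X + 1))
  -- An antidifference is free up to a constant, chosen here to match `h` at `N`.
  refine ⟨Q + Polynomial.C (h N - Q.eval (N : ℚ)), N, fun s hs => ?_⟩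
  induction s, hs using Nat.le_induction with
  | base => simp
  | succ s hs ih =>
    rw [hh, Nat.cast_add, ih, hP (s + 1) (by omega)]
    have := hQ s
    simp only [Polynomial.eval_add, Polynomial.eval_C, Polynomial.eval_comp, Polynomial.eval_X,
      Polynomial.eval_one] at this ⊢
    push_cast
    rw [add_comm (s : ℚ) 1, this, add_comm (s : ℚ) 1]
    ring

theorem EventuallyPolynomial.of_sum {h g k : ℕ → ℕ} (hg : EventuallyPolynomial g)
    (hk : EventuallyPolynomial k) (hh : ∀ s, h (s + 1) = g (s + 1) + k s) :
    EventuallyPolynomial h := by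
  obtain ⟨P, N, hP⟩ := hg
  obtain ⟨Q, N', hQ⟩ := hk
  refine ⟨P + Q.comp (Polynomial.X - 1), N + N' + 1, fun s hs => ?_⟩
  obtain ⟨s, rfl⟩ : ∃ r, s = r + 1 := ⟨s - 1, by omega⟩
  rw [hh, Nat.cast_add, hP _ (by omega), hQ _ (by omega)]
  simp

/-- If `deg Q < deg P`, then `Q / P → 0`. But `P` has finitely many roots, so it is eventually
positive and `Q / P ≥ 1`. -/
theorem degree_le_of_eventually_le {P Q : Polynomial ℚ} (h0 : ∀ᶠ s : ℕ in atTop, 0 ≤ P.eval (s : ℚ))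
    (h : ∀ᶠ s : ℕ in atTop, P.eval (s : ℚ) ≤ Q.eval (s : ℚ)) : P.degree ≤ Q.degree := by
  by_contra! hlt
  have hP : P ≠ 0 := by rintro rfl; simp at hlt
  have h1 := (Polynomial.div_tendsto_atTop_zero_of_degree_lt Q P hlt).comp
    (tendsto_natCast_atTop_atTop (R := ℚ))
  have h2 := h1.eventually (gt_mem_nhds one_pos)
  have h3 : ∀ᶠ s : ℕ in atTop, P.eval (s : ℚ) ≠ 0 := by
    have hf : {s : ℕ | P.eval (s : ℚ) = 0}.Finite := by
      have := (P.rootSet_finite ℚ).preimage (f := fun s : ℕ => (s : ℚ))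
        (fun a _ b _ hab => by simpa using hab)
      refine this.subset fun s hs => ?_
      simp only [Set.mem_preimage, Polynomial.mem_rootSet, Polynomial.coe_aeval_eq_eval]
      exact ⟨hP, hs⟩
    have := hf.eventually_cofinite_notMem
    rwa [Nat.cofinite_eq_atTop] at this
  obtain ⟨s, a, b, c, d⟩ := (h0.and (h.and (h2.and h3))).exists
  have e : 0 < P.eval (s : ℚ) := lt_of_le_of_ne a (Ne.symm d)
  simp only [Function.comp_apply] at c
  rw [div_lt_one e] at c
  linarith

end EventuallyPolynomial

/-! ### Counting lattice points of lower sets. -/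

section Count

variable {N : ℕ}

/-- The number of points of `D` of total degree at most `ν`. -/
def degCount (D : Set (Fin N → ℕ)) (ν : ℕ) : ℕ := {α | α ∈ D ∧ ∑ i, α i ≤ ν}.ncard

theorem finite_sum_le (ν : ℕ) : {α : Fin N → ℕ | ∑ i, α i ≤ ν}.Finite := by
  refine (Set.finite_Iic (fun _ => ν : Fin N → ℕ)).subset fun α hα i => ?_
  exact (Finset.single_le_sum (f := α) (fun _ _ => Nat.zero_le _) (Finset.mem_univ i)).trans hα

theorem finite_mem_and_sum_le (D : Set (Fin N → ℕ)) (ν : ℕ) :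
    {α | α ∈ D ∧ ∑ i, α i ≤ ν}.Finite :=
  (finite_sum_le ν).subset fun _ h => h.2

/-- A point either has first coordinate zero, and is a point of a slice in one dimension less, or is
the translate by the first unit vector of a point of degree one less. -/
theorem degCount_succ (D : Set (Fin (N + 1) → ℕ)) (ν : ℕ) :
    degCount D (ν + 1) = degCount {v : Fin N → ℕ | Fin.cons 0 v ∈ D} (ν + 1) +
      degCount {α | α + Pi.single 0 1 ∈ D} ν := by
  have h : {α | α ∈ D ∧ ∑ i, α i ≤ ν + 1} =
      (fun v : Fin N → ℕ => (Fin.cons 0 v : Fin (N + 1) → ℕ)) ''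
        {v : Fin N → ℕ | v ∈ {v : Fin N → ℕ | Fin.cons 0 v ∈ D} ∧ ∑ i, v i ≤ ν + 1} ∪
      (fun α => α + Pi.single 0 1) ''
        {α : Fin (N + 1) → ℕ | α ∈ {α : Fin (N + 1) → ℕ | α + Pi.single 0 1 ∈ D} ∧ ∑ i, α i ≤ ν} := by
    ext α
    constructor
    · rintro ⟨h1, h2⟩
      rcases Nat.eq_zero_or_pos (α 0) with h0 | h0
      · left
        have : Fin.cons 0 (Fin.tail α) = α := by rw [← h0, Fin.cons_self_tail]
        refine ⟨Fin.tail α, ⟨by simpa [this] using h1, ?_⟩, this⟩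
        rw [Fin.sum_univ_succ, h0, zero_add] at h2
        exact h2
      · right
        have : α - Pi.single 0 1 + Pi.single 0 1 = α := by
          refine tsub_add_cancel_of_le fun i => ?_
          by_cases hi : i = 0
          · subst hi; simpa using Nat.succ_le_of_lt h0
          · simp [hi]
        refine ⟨α - Pi.single 0 1, ⟨by simpa [this] using h1, ?_⟩, this⟩
        rw [← this] at h2
        simpa [Finset.sum_add_distrib] using h2
    · rintro (⟨v, ⟨h1, h2⟩, rfl⟩ | ⟨α, ⟨h1, h2⟩, rfl⟩)
      · exact ⟨h1, by simpa [Fin.sum_univ_succ] using h2⟩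
      · exact ⟨h1, by simpa [Finset.sum_add_distrib] using h2⟩
  have hcons : Function.Injective fun v : Fin N → ℕ => (Fin.cons 0 v : Fin (N + 1) → ℕ) :=
    Fin.cons_right_injective (α := fun _ => ℕ) 0
  rw [degCount, h, Set.ncard_union_eq _ ((finite_mem_and_sum_le _ _).image _)
    ((finite_mem_and_sum_le _ _).image _),
    Set.ncard_image_of_injective _ hcons, Set.ncard_image_of_injective _ (add_left_injective _)]
  · rfl
  · rw [Set.disjoint_left]
    rintro _ ⟨v, -, rfl⟩ ⟨α, -, h⟩
    simpa using congrFun h 0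

/-- Dickson's lemma. If the chain dropped infinitely often, choose a point lost at each drop.
Well-quasi-ordering gives an earlier point below a later one; the later one survives the earlier
drop, so the earlier one does too, the sets being lower. -/
theorem exists_stable_of_antitone {D : ℕ → Set (Fin N → ℕ)} (hD : Antitone D)
    (hl : ∀ c, IsLowerSet (D c)) : ∃ C, ∀ c ≥ C, D c = D C := by
  by_contra! h
  choose g hg hne using h
  have h2 : ∀ C, ∃ e, e ∈ D C ∧ e ∉ D (g C) := fun C => by
    by_contra! h3
    exact hne C (Set.Subset.antisymm (hD (hg C)) h3)
  choose e he he' using h2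
  let c : ℕ → ℕ := fun i => g^[i] 0
  have hc : Monotone c := monotone_nat_of_le_succ fun i => by
    simp only [c, Function.iterate_succ_apply']
    exact hg _
  obtain ⟨i, j, hij, hle⟩ := wellQuasiOrdered_le (α := Fin N → ℕ) fun i => e (c i)
  refine he' (c i) (hl _ hle ?_)
  have : g (c i) ≤ c j := by
    have := hc (Nat.succ_le_of_lt hij)
    simpa only [c, Nat.succ_eq_add_one, Function.iterate_succ_apply'] using this
  exact hD this (he (c j))

/-- The Hilbert function of a lower set is eventually polynomial. -/
theorem eventuallyPolynomial_degCount : ∀ {N : ℕ} {D : Set (Fin N → ℕ)}, IsLowerSet D →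
    EventuallyPolynomial (degCount D)
  | 0, D, _ => by
    refine ⟨Polynomial.C (degCount D 0 : ℚ), 0, fun s _ => ?_⟩
    simp [degCount]
  | N + 1, D, hD => by
    -- `E c` is `D` moved down by `c` along the first axis; these sets decrease, hence stabilize.
    let E : ℕ → Set (Fin (N + 1) → ℕ) := fun c => {α | α + Pi.single 0 c ∈ D}
    have hE : Antitone E := fun a b hab α hα =>
      hD (add_le_add_right (Pi.single_le_single.mpr hab) α) hα
    have hl : ∀ c, IsLowerSet (E c) := fun c a b hab ha => hD (add_le_add_left hab _) ha
    have hs : ∀ c, {α | α + Pi.single 0 1 ∈ E c} = E (c + 1) := fun c => by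
      ext α
      simp only [E, Set.mem_ofPred_eq, add_assoc, ← Pi.single_add, add_comm c]
    have h0 : ∀ c, EventuallyPolynomial (degCount {v : Fin N → ℕ | Fin.cons 0 v ∈ E c}) :=
      fun c => eventuallyPolynomial_degCount fun a b hab ha =>
        hl c (Fin.cons_le_cons.mpr ⟨le_rfl, hab⟩) ha
    obtain ⟨C, hC⟩ := exists_stable_of_antitone hE hl
    -- Downward induction: at the stable index, `degCount_succ` is a first-order recursion for the
    -- count itself; below it, the translated set has already been treated.
    have hstep : ∀ c ≤ C, EventuallyPolynomial (degCount (E c)) := by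
      intro c hc
      induction hc using Nat.decreasingInduction with
      | self =>
        refine (h0 C).of_step fun s => ?_
        rw [degCount_succ, hs, hC (C + 1) (by omega)]
      | of_succ c _ ih =>
        refine (h0 c).of_sum ih fun s => ?_
        rw [degCount_succ, hs]
    have h1 : E 0 = D := by ext; simp [E]
    exact h1 ▸ hstep 0 (Nat.zero_le _)

/-- If `D` omits the upper set of a point, its Hilbert function has degree less than `N`. -/
theorem degCount_le_of_forall_not_le {D : Set (Fin (N + 1) → ℕ)} {α : Fin (N + 1) → ℕ}
    (h : ∀ β ∈ D, ¬ α ≤ β) (ν : ℕ) : degCount D ν ≤ (∑ i, α i) * (ν + 1) ^ N := by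
  classical
  -- A point not above `α` has some coordinate `j` below `α j`. The corresponding box has `α j * (ν
  -- + 1) ^ N` points.
  let T : Fin (N + 1) → Finset (Fin (N + 1) → ℕ) := fun j =>
    Fintype.piFinset fun i => if i = j then Finset.range (α j) else Finset.range (ν + 1)
  have hsub : {β | β ∈ D ∧ ∑ i, β i ≤ ν} ⊆ (Finset.univ.biUnion T : Finset _) := by
    rintro β ⟨h1, h2⟩
    obtain ⟨j, hj⟩ : ∃ j, β j < α j := by simpa [Pi.le_def] using h β h1
    simp only [Finset.coe_biUnion, Finset.coe_univ, Set.mem_univ, Set.iUnion_true, Set.mem_iUnion,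
      SetLike.mem_coe, T, Fintype.mem_piFinset]
    refine ⟨j, fun i => ?_⟩
    split_ifs with hi
    · subst hi; simpa using hj
    · have := (Finset.single_le_sum (f := β) (fun _ _ => Nat.zero_le _) (Finset.mem_univ i)).trans h2
      simp; omega
  refine (Set.ncard_le_ncard hsub (Finset.finite_toSet _)).trans ?_
  rw [Set.ncard_coe_finset]
  refine Finset.card_biUnion_le.trans (le_of_eq ?_)
  rw [Finset.sum_mul]
  refine Finset.sum_congr rfl fun j _ => ?_
  simp only [T, Fintype.card_piFinset]
  rw [← Finset.mul_prod_erase _ _ (Finset.mem_univ j), if_pos rfl, Finset.card_range]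
  congr 1
  rw [Finset.prod_congr rfl (g := fun _ => ν + 1) fun i hi => by
    rw [if_neg (Finset.ne_of_mem_erase hi), Finset.card_range]]
  simp [Finset.card_erase_of_mem]

end Count

/-! ### Reordering words in quasi-commuting generators. -/

section Words

section Monomials

variable {A : Type*} [Ring A] {N : ℕ}

/-- The ordered monomial with exponents `α`. -/
def orderedMonomial (x : Fin N → A) (α : Fin N → ℕ) : A := (List.ofFn fun j => x j ^ α j).prod

/-- The sorted word with exponents `α`. -/
def sortedWord (α : Fin N → ℕ) : List (Fin N) := (List.ofFn fun j => List.replicate (α j) j).flatten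

theorem prod_sortedWord (x : Fin N → A) (α : Fin N → ℕ) :
    ((sortedWord α).map x).prod = orderedMonomial x α := by
  simp [sortedWord, orderedMonomial, List.map_flatten, List.prod_flatten, List.map_ofFn,
    Function.comp_def]

theorem length_sortedWord (α : Fin N → ℕ) : (sortedWord α).length = ∑ i, α i := by
  simp [sortedWord, List.length_flatten, List.map_ofFn, List.sum_ofFn, Function.comp_def]

theorem count_sortedWord (α : Fin N → ℕ) (j : Fin N) : (sortedWord α).count j = α j := by
  simp [sortedWord, List.count_flatten, List.map_ofFn, List.sum_ofFn, Function.comp_def,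
    List.count_replicate]

end Monomials

variable {K A : Type*} [Field K] [Ring A] [Module K A] {N : ℕ}

/-- The span of the words of length less than `ν` in the generators `x`. -/
def wordSpan (K : Type*) {A : Type*} [Field K] [Ring A] [Module K A] {N : ℕ} (x : Fin N → A)
    (ν : ℕ) : Submodule K A :=
  Submodule.span K {a | ∃ w : List (Fin N), w.length < ν ∧ (w.map x).prod = a}

/-- The generators `x` are semilinear, and commute up to words of length at most one. -/
structure QuasiCommuting (K : Type*) {A : Type*} [Field K] [Ring A] [Module K A] {N : ℕ}
    (x : Fin N → A) : Prop where
  semilinear : ∀ i, ∃ σ : K → K, ∀ (c : K) (a : A), x i * c • a = σ c • (x i * a)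
  comm : ∀ i j, x i * x j - x j * x i ∈ wordSpan K x 2

variable {x : Fin N → A}

theorem wordSpan_mono : Monotone (wordSpan K x) := fun _ _ h =>
  Submodule.span_mono fun _ ⟨w, hw, e⟩ => ⟨w, hw.trans_le h, e⟩

theorem word_mem_wordSpan {w : List (Fin N)} {ν : ℕ} (h : w.length < ν) :
    (w.map x).prod ∈ wordSpan K x ν :=
  Submodule.subset_span ⟨w, h, rfl⟩

theorem QuasiCommuting.word_semilinear (hx : QuasiCommuting K x) (w : List (Fin N)) :
    ∃ σ : K → K, ∀ (c : K) (a : A), (w.map x).prod * c • a = σ c • ((w.map x).prod * a) := by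
  induction w with
  | nil => exact ⟨id, by simp⟩
  | cons i w ih =>
    obtain ⟨σ, hσ⟩ := ih
    obtain ⟨ρ, hρ⟩ := hx.semilinear i
    refine ⟨ρ ∘ σ, fun c a => ?_⟩
    rw [List.map_cons, List.prod_cons, mul_assoc, hσ, hρ, mul_assoc, Function.comp_apply]

theorem QuasiCommuting.word_mul_mem (hx : QuasiCommuting K x) (w : List (Fin N)) {ν : ℕ} {a : A}
    (ha : a ∈ wordSpan K x ν) : (w.map x).prod * a ∈ wordSpan K x (w.length + ν) := by
  induction ha using Submodule.span_induction with
  | mem a h =>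
    obtain ⟨w', h, rfl⟩ := h
    rw [← List.prod_append, ← List.map_append]
    exact word_mem_wordSpan (by simp [h])
  | zero => simp
  | add a b _ _ ha hb => rw [mul_add]; exact add_mem ha hb
  | smul c a _ ha =>
    obtain ⟨σ, hσ⟩ := hx.word_semilinear w
    rw [hσ]
    exact Submodule.smul_mem _ _ ha

theorem orderedMonomial_mem {α : Fin N → ℕ} {ν : ℕ} (h : ∑ i, α i < ν) :
    orderedMonomial x α ∈ wordSpan K x ν := by
  rw [← prod_sortedWord]
  exact word_mem_wordSpan (by rwa [length_sortedWord])

variable [IsScalarTower K A A]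

theorem mul_word_mem (w : List (Fin N)) {ν : ℕ} {a : A}
    (ha : a ∈ wordSpan K x ν) : a * (w.map x).prod ∈ wordSpan K x (ν + w.length) := by
  induction ha using Submodule.span_induction with
  | mem a h =>
    obtain ⟨w', h, rfl⟩ := h
    rw [← List.prod_append, ← List.map_append]
    exact word_mem_wordSpan (by simp [h])
  | zero => simp
  | add a b _ _ ha hb => rw [add_mul]; exact add_mem ha hb
  | smul c a _ ha =>
    rw [smul_mul_assoc]
    exact Submodule.smul_mem _ _ ha

/-- An adjacent swap replaces two letters by a commutator, that is, by words of length at most one.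
The bound in `wordSpan` is strict, so the error is of lower order. Semilinearity lets a prefix pass
the scalars of the error term. -/
theorem QuasiCommuting.sub_mem_of_perm (hx : QuasiCommuting K x) {w w' : List (Fin N)}
    (h : w.Perm w') : (w.map x).prod - (w'.map x).prod ∈ wordSpan K x w.length := by
  induction h with
  | nil => simp
  | cons i _ ih =>
    have := hx.word_mul_mem [i] ih
    simpa [mul_sub, add_comm] using this
  | swap i j w =>
    have := mul_word_mem w (hx.comm j i)
    simp only [List.map_cons, List.prod_cons, List.length_cons]
    rwa [sub_mul, mul_assoc, mul_assoc, add_comm] at this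
  | trans h1 h2 ih1 ih2 =>
    rw [← h1.length_eq] at ih2
    simpa using add_mem ih1 ih2

theorem QuasiCommuting.word_sub_mem (hx : QuasiCommuting K x) (w : List (Fin N)) :
    (w.map x).prod - orderedMonomial x (fun j => w.count j) ∈ wordSpan K x w.length := by
  rw [← prod_sortedWord]
  exact hx.sub_mem_of_perm (List.perm_iff_count.mpr fun j => (count_sortedWord (fun j => w.count j) j).symm)

/-- Exponents add under multiplication modulo lower order, as for commuting variables. -/
theorem QuasiCommuting.monomial_mul_sub_mem (hx : QuasiCommuting K x) (γ α : Fin N → ℕ) :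
    orderedMonomial x γ * orderedMonomial x α - orderedMonomial x (γ + α) ∈
      wordSpan K x (∑ i, (γ + α) i) := by
  have := hx.word_sub_mem (sortedWord γ ++ sortedWord α)
  simp only [List.map_append, List.prod_append, prod_sortedWord, List.count_append,
    count_sortedWord, List.length_append, length_sortedWord, ← Finset.sum_add_distrib] at this
  exact this

/-- Sorting a word leaves an error made of shorter words, which induction on the length handles. -/
theorem QuasiCommuting.wordSpan_eq (hx : QuasiCommuting K x) (ν : ℕ) :
    wordSpan K x ν = Submodule.span K (orderedMonomial x '' {α | ∑ i, α i < ν}) := by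
  apply le_antisymm
  · induction ν with
    | zero => simp [wordSpan]
    | succ ν ih =>
      rw [wordSpan, Submodule.span_le]
      rintro _ ⟨w, hw, rfl⟩
      have hlen : ∑ j, w.count j = w.length := by
        rw [← length_sortedWord]
        exact (List.perm_iff_count.mpr fun j => count_sortedWord (fun j => w.count j) j).length_eq
      have h1 := wordSpan_mono (Nat.lt_succ_iff.mp hw) (hx.word_sub_mem w)
      have h2 := (ih.trans (Submodule.span_mono (Set.image_mono fun α (h : _ < ν) =>
        h.trans ν.lt_succ_self))) h1
      have h3 : orderedMonomial x (fun j => w.count j) ∈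
          Submodule.span K (orderedMonomial x '' {α | ∑ i, α i < ν + 1}) :=
        Submodule.subset_span ⟨_, hlen.trans_lt hw, rfl⟩
      have h4 := add_mem h2 h3
      rwa [sub_add_cancel] at h4
  · rw [Submodule.span_le]
    rintro _ ⟨α, hα, rfl⟩
    exact orderedMonomial_mem hα

theorem QuasiCommuting.mul_mem (hx : QuasiCommuting K x) {i j : ℕ} {a b : A}
    (ha : a ∈ wordSpan K x (i + 1)) (hb : b ∈ wordSpan K x (j + 1)) :
    a * b ∈ wordSpan K x (i + j + 1) := by
  induction ha using Submodule.span_induction with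
  | mem a h =>
    obtain ⟨w', h, rfl⟩ := h
    exact wordSpan_mono (by omega) (hx.word_mul_mem w' hb)
  | zero => simp
  | add a b _ _ ha hb => rw [add_mul]; exact add_mem ha hb
  | smul c a _ ha =>
    rw [smul_mul_assoc]
    exact Submodule.smul_mem _ _ ha

end Words

/-! ### Normal exponents and the Hilbert function of a cyclic module. -/

section Normal

variable {N : ℕ}

/-- The degree-lexicographic order of exponents. -/
def degLexKey (α : Fin N → ℕ) : DegLex (Fin N →₀ ℕ) := toDegLex (Finsupp.equivFunOnFinite.symm α)

theorem degLexKey_injective : Function.Injective (degLexKey (N := N)) :=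
  toDegLex_injective.comp (Equiv.injective _)

theorem degLexKey_add (α β : Fin N → ℕ) : degLexKey (α + β) = degLexKey α + degLexKey β := by
  rw [degLexKey, degLexKey, degLexKey, ← toDegLex_add]
  congr 1
  ext i
  simp

theorem degree_degLexKey (α : Fin N → ℕ) : (ofDegLex (degLexKey α)).degree = ∑ i, α i := by
  simp [degLexKey, Finsupp.degree_eq_sum]

theorem degLexKey_lt_of_sum_lt {α β : Fin N → ℕ} (h : ∑ i, α i < ∑ i, β i) :
    degLexKey α < degLexKey β := by
  rw [Finsupp.DegLex.lt_iff, degree_degLexKey, degree_degLexKey]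
  exact Or.inl h

theorem sum_le_of_degLexKey_lt {α β : Fin N → ℕ} (h : degLexKey α < degLexKey β) :
    ∑ i, α i ≤ ∑ i, β i := by
  rw [Finsupp.DegLex.lt_iff, degree_degLexKey, degree_degLexKey] at h
  exact h.elim le_of_lt fun h => h.1.le

/-- In a nontrivial relation, the term with the largest key could be solved for in terms of earlier
ones. -/
theorem linearIndependent_of_notMem_span_lt {K V ι S : Type*} [Field K] [AddCommGroup V]
    [Module K V] [LinearOrder S] (v : ι → V) (key : ι → S) (hkey : Function.Injective key)
    (h : ∀ i, v i ∉ Submodule.span K (v '' {j | key j < key i})) : LinearIndependent K v := by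
  classical
  rw [linearIndependent_iff']
  intro s g hg
  by_contra! hne
  obtain ⟨i, his, hi⟩ := hne
  obtain ⟨m, hm, hmax⟩ := (s.filter fun i => g i ≠ 0).exists_max_image key
    ⟨i, by simp [his, hi]⟩
  rw [Finset.mem_filter] at hm
  refine h m ?_
  rw [← Finset.add_sum_erase _ _ hm.1, add_eq_zero_iff_eq_neg] at hg
  rw [← Submodule.smul_mem_iff _ hm.2, hg]
  refine neg_mem (sum_mem fun j hj => ?_)
  rw [Finset.mem_erase] at hj
  by_cases hj0 : g j = 0
  · simp [hj0]
  · refine Submodule.smul_mem _ _ (Submodule.subset_span ⟨j, ?_, rfl⟩)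
    exact lt_of_le_of_ne (hmax j (by simp [hj, hj0])) fun e => hj.1 (hkey e)

/-- The exponents `α` such that `x ^ α f` is not a combination of earlier `x ^ β f`. -/
def normalExponents (K : Type*) {A M : Type*} [Field K] [Ring A] [AddCommGroup M] [Module A M]
    [Module K M] {N : ℕ} (x : Fin N → A) (f : M) : Set (Fin N → ℕ) :=
  {α | orderedMonomial x α • f ∉
    Submodule.span K ((fun β => orderedMonomial x β • f) '' {β | degLexKey β < degLexKey α})}

/-- Non-normal monomials are rewritten by smaller ones, which terminates since the order is
well-founded. As degree is compared first, rewriting never raises the total degree and so respects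
the filtration. -/
theorem smul_mem_span_normalExponents {K A M : Type*} [Field K] [Ring A] [AddCommGroup M]
    [Module A M] [Module K M] (x : Fin N → A) (f : M) (α : Fin N → ℕ) :
    orderedMonomial x α • f ∈ Submodule.span K ((fun β => orderedMonomial x β • f) ''
      {β | β ∈ normalExponents K x f ∧ ∑ i, β i ≤ ∑ i, α i}) := by
  refine (InvImage.wf degLexKey wellFounded_lt).induction (C := fun α => orderedMonomial x α • f ∈
    Submodule.span K ((fun β => orderedMonomial x β • f) ''
      {β | β ∈ normalExponents K x f ∧ ∑ i, β i ≤ ∑ i, α i})) α fun α ih => ?_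
  by_cases hα : α ∈ normalExponents K x f
  · exact Submodule.subset_span ⟨α, ⟨hα, le_rfl⟩, rfl⟩
  · refine (Submodule.span_le.mpr ?_) (not_not.mp hα)
    rintro _ ⟨β, hβ, rfl⟩
    refine Submodule.span_mono (Set.image_mono ?_) (ih β hβ)
    rintro γ ⟨h1, h2⟩
    exact ⟨h1, h2.trans (sum_le_of_degLexKey_lt hβ)⟩

/-- `a ↦ a f`. -/
def evalAt (K : Type*) {A M : Type*} [Field K] [Ring A] [Module K A] [AddCommGroup M] [Module A M]
    [Module K M] [IsScalarTower K A M] (f : M) : A →ₗ[K] M where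
  toFun a := a • f
  map_add' a b := add_smul a b f
  map_smul' c a := smul_assoc c a f

variable {K A M : Type*} [Field K] [Ring A] [Module K A] [IsScalarTower K A A] [AddCommGroup M]
  [Module A M] [Module K M] [IsScalarTower K A M] {x : Fin N → A}

theorem QuasiCommuting.map_wordSpan (hx : QuasiCommuting K x) (f : M) (ν : ℕ) :
    (wordSpan K x ν).map (evalAt K f) =
      Submodule.span K ((fun β => orderedMonomial x β • f) '' {α | ∑ i, α i < ν}) := by
  rw [hx.wordSpan_eq, Submodule.map_span, Set.image_image]
  rfl

theorem QuasiCommuting.smul_mem_span_lt (hx : QuasiCommuting K x) (f : M) {a : A}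
    {α : Fin N → ℕ} (ha : a ∈ wordSpan K x (∑ i, α i)) : a • f ∈
    Submodule.span K ((fun β => orderedMonomial x β • f) '' {β | degLexKey β < degLexKey α}) := by
  have h1 : evalAt K f a ∈ _ := Submodule.mem_map_of_mem ha
  rw [hx.map_wordSpan] at h1
  exact Submodule.span_mono (Set.image_mono fun β hβ => degLexKey_lt_of_sum_lt hβ) h1

/-- Multiplying an expression of `x ^ α f` through earlier `x ^ δ f` by `x ^ γ` gives, modulo lower
order, an expression of `x ^ (γ + α) f` through `x ^ (γ + δ) f`. The order is translation invariant,
so these are still earlier. -/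
theorem QuasiCommuting.isLowerSet_normalExponents (hx : QuasiCommuting K x) (f : M) :
    IsLowerSet (normalExponents K x f) := by
  intro β α hαβ hβ
  by_contra hα
  refine hβ ?_
  obtain ⟨γ, rfl⟩ : ∃ γ, β = γ + α := ⟨β - α, (tsub_add_cancel_of_le hαβ).symm⟩
  have key : ∀ δ, orderedMonomial x γ • orderedMonomial x δ • f - orderedMonomial x (γ + δ) • f ∈
      Submodule.span K ((fun β => orderedMonomial x β • f) ''
        {β | degLexKey β < degLexKey (γ + δ)}) := fun δ => by
    rw [← mul_smul, ← sub_smul]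
    exact hx.smul_mem_span_lt f (hx.monomial_mul_sub_mem γ δ)
  obtain ⟨σ, hσ⟩ := hx.word_semilinear (sortedWord γ)
  rw [prod_sortedWord] at hσ
  have hσ' : ∀ (c : K) (v : M), orderedMonomial x γ • c • v = σ c • orderedMonomial x γ • v :=
    fun c v => by
      have := congrArg (· • v) (hσ c 1)
      simpa [mul_smul, smul_assoc] using this
  have h2 : orderedMonomial x γ • orderedMonomial x α • f ∈
      Submodule.span K ((fun β => orderedMonomial x β • f) ''
        {β | degLexKey β < degLexKey (γ + α)}) := by
    rw [normalExponents, Set.notMem_ofPred_iff, not_not] at hα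
    generalize orderedMonomial x α • f = v at hα
    induction hα using Submodule.span_induction with
    | mem v h =>
      obtain ⟨δ, hδ, rfl⟩ := h
      have hlt : degLexKey (γ + δ) < degLexKey (γ + α) := by
        rw [degLexKey_add, degLexKey_add]
        exact add_lt_add_right hδ _
      have h3 := Submodule.span_mono (Set.image_mono fun β (hβ : _ < _) => hβ.trans hlt) (key δ)
      have h4 := add_mem h3 (Submodule.subset_span ⟨γ + δ, hlt, rfl⟩)
      rwa [sub_add_cancel] at h4
    | zero => simp
    | add a b _ _ ha hb => rw [smul_add]; exact add_mem ha hb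
    | smul c a _ ha => rw [hσ']; exact Submodule.smul_mem _ _ ha
  simpa using sub_mem h2 (key α)

theorem QuasiCommuting.map_wordSpan_eq_normal (hx : QuasiCommuting K x) (f : M) (ν : ℕ) :
    (wordSpan K x (ν + 1)).map (evalAt K f) = Submodule.span K
      ((fun β => orderedMonomial x β • f) '' {β | β ∈ normalExponents K x f ∧ ∑ i, β i ≤ ν}) := by
  rw [hx.map_wordSpan]
  apply le_antisymm
  · rw [Submodule.span_le]
    rintro _ ⟨α, hα, rfl⟩
    refine Submodule.span_mono (Set.image_mono ?_) (smul_mem_span_normalExponents x f α)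
    rintro γ ⟨h1, h2⟩
    exact ⟨h1, h2.trans (Nat.lt_succ_iff.mp hα)⟩
  · exact Submodule.span_mono (Set.image_mono fun β hβ => Nat.lt_succ_iff.mpr hβ.2)

/-- The normal `x ^ α f` are independent by their definition and span by rewriting, so they form a
basis in each order. -/
theorem QuasiCommuting.finrank_map_wordSpan (hx : QuasiCommuting K x) (f : M) (ν : ℕ) :
    Module.finrank K ((wordSpan K x (ν + 1)).map (evalAt K f)) =
      degCount (normalExponents K x f) ν := by
  have hli : LinearIndependent K
      (fun α : normalExponents K x f => orderedMonomial x α.1 • f) := by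
    refine linearIndependent_of_notMem_span_lt _ (fun α => degLexKey α.1)
      (degLexKey_injective.comp Subtype.val_injective) fun α h => α.2 ?_
    refine Submodule.span_mono ?_ h
    rintro _ ⟨β, hβ, rfl⟩
    exact ⟨β.1, hβ, rfl⟩
  have hli' := hli.comp (Set.inclusion (s := {β | β ∈ normalExponents K x f ∧ ∑ i, β i ≤ ν})
    fun _ h => h.1) (Set.inclusion_injective _)
  have := (finite_mem_and_sum_le (normalExponents K x f) ν).fintype
  rw [hx.map_wordSpan_eq_normal, Set.image_eq_range, degCount]
  refine (finrank_span_eq_card hli').trans ?_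
  rw [← Nat.card_eq_fintype_card]
  rfl

theorem QuasiCommuting.finiteDimensional_map_wordSpan (hx : QuasiCommuting K x) (f : M) (ν : ℕ) :
    FiniteDimensional K ((wordSpan K x ν).map (evalAt K f)) := by
  rw [hx.map_wordSpan]
  refine FiniteDimensional.span_of_finite K (((finite_sum_le ν).subset fun α h => ?_).image _)
  exact (show ∑ i, α i < ν from h).le

/-- If a nonzero combination of words kills `f`, not all exponents are normal. -/
theorem QuasiCommuting.exists_notMem_normalExponents (hx : QuasiCommuting K x) (f : M) {φ : A}
    {ν : ℕ} (hφ : φ ∈ wordSpan K x ν) (h0 : φ ≠ 0) (hf : φ • f = 0) :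
    ∃ α, α ∉ normalExponents K x f := by
  by_contra! h
  -- Independence after application to `f` suffices: the monomials need not be known in advance to
  -- be independent in the ring.
  have hli : LinearIndependent K (fun α => orderedMonomial x α • f) :=
    linearIndependent_of_notMem_span_lt _ degLexKey degLexKey_injective h
  rw [hx.wordSpan_eq] at hφ
  obtain ⟨c, -, rfl⟩ := (Finsupp.mem_span_image_iff_linearCombination K).mp hφ
  refine h0 ?_
  have h1 : Finsupp.linearCombination K (fun α => orderedMonomial x α • f) c = 0 := by
    rw [← hf, Finsupp.linearCombination_apply, Finsupp.linearCombination_apply, Finsupp.sum,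
      Finsupp.sum, Finset.sum_smul]
    simp only [smul_assoc]
  rw [linearIndependent_iff.mp hli c h1, map_zero]

end Normal

/-! ### Commutation relations for operators on germs. -/

section Relations

variable (Fq : Type*) [Field Fq] [Fintype Fq] {n : ℕ}

theorem germTau_smul (c : Kc Fq) (f : FunGerm Fq n) :
    germTau Fq n (c • f) = frob Fq c • germTau Fq n f := by
  induction f using Germ.inductionOn with
  | h u => exact congrArg _ (funext fun z => map_mul (frob Fq) c (u z))

theorem germRoot_smul (c : Kc Fq) (f : FunGerm Fq n) :
    germRoot Fq n (c • f) = (frob Fq).symm c • germRoot Fq n f := by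
  induction f using Germ.inductionOn with
  | h u => exact congrArg _ (funext fun z => map_mul (frob Fq).symm c (u z))

theorem germScaleS_smul (c : Kc Fq) (f : FunGerm Fq n) :
    germScaleS Fq n (c • f) = c • germScaleS Fq n f := by
  induction f using Germ.inductionOn with
  | h u => rfl

theorem germScaleT_smul (j : Fin n) (c : Kc Fq) (f : FunGerm Fq n) :
    germScaleT Fq n j (c • f) = c • germScaleT Fq n j f := by
  induction f using Germ.inductionOn with
  | h u => rfl

theorem germRoot_germTau (f : FunGerm Fq n) : germRoot Fq n (germTau Fq n f) = f := by
  induction f using Germ.inductionOn with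
  | h u => exact congrArg _ (funext fun z => (frob Fq).symm_apply_apply (u z))

theorem germTau_germRoot (f : FunGerm Fq n) : germTau Fq n (germRoot Fq n f) = f := by
  induction f using Germ.inductionOn with
  | h u => exact congrArg _ (funext fun z => (frob Fq).apply_symm_apply (u z))

theorem germScaleS_germTau (f : FunGerm Fq n) :
    germScaleS Fq n (germTau Fq n f) = germTau Fq n (germScaleS Fq n f) := by
  induction f using Germ.inductionOn with
  | h u => rfl

theorem germScaleT_germTau (j : Fin n) (f : FunGerm Fq n) :
    germScaleT Fq n j (germTau Fq n f) = germTau Fq n (germScaleT Fq n j f) := by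
  induction f using Germ.inductionOn with
  | h u => rfl

theorem germScaleT_germRoot (j : Fin n) (f : FunGerm Fq n) :
    germScaleT Fq n j (germRoot Fq n f) = germRoot Fq n (germScaleT Fq n j f) := by
  induction f using Germ.inductionOn with
  | h u => rfl

theorem germScaleT_germScaleS (j : Fin n) (f : FunGerm Fq n) :
    germScaleT Fq n j (germScaleS Fq n f) = germScaleS Fq n (germScaleT Fq n j f) := by
  induction f using Germ.inductionOn with
  | h u => rfl

theorem germScaleT_comm (i j : Fin n) (f : FunGerm Fq n) :
    germScaleT Fq n i (germScaleT Fq n j f) = germScaleT Fq n j (germScaleT Fq n i f) := by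
  induction f using Germ.inductionOn with
  | h u =>
    refine congrArg _ (funext fun z => congrArg u ?_)
    rcases eq_or_ne i j with rfl | hij
    · rfl
    · simp [scaleT, hij, hij.symm, Function.update_comm hij]

theorem germD_apply (f : FunGerm Fq n) :
    germD Fq n f = germRoot Fq n (germScaleS Fq n f - indet Fq • f) := rfl

theorem germDelta_apply (j : Fin n) (f : FunGerm Fq n) :
    germDelta Fq n j f = germScaleT Fq n j f - indet Fq • f := rfl

/-- Here `d_s τ u = u(xs, t) - x ^ (1/q) u`, whereas `τ d_s u = u(xs, t) - x u`. -/
theorem germD_germTau (f : FunGerm Fq n) : germD Fq n (germTau Fq n f) =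
    germTau Fq n (germD Fq n f) + (indet Fq - (frob Fq).symm (indet Fq)) • f := by
  rw [germD_apply, germD_apply, germTau_germRoot, map_sub, germRoot_smul, germRoot_germTau,
    germScaleS_germTau, germRoot_germTau, sub_smul]
  abel

theorem germDelta_germTau (j : Fin n) (f : FunGerm Fq n) : germDelta Fq n j (germTau Fq n f) =
    germTau Fq n (germDelta Fq n j f) + (frob Fq (indet Fq) - indet Fq) • germTau Fq n f := by
  simp only [germDelta_apply, map_sub, germTau_smul, germScaleT_germTau, sub_smul]
  abel

theorem germDelta_germD (j : Fin n) (f : FunGerm Fq n) : germDelta Fq n j (germD Fq n f) =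
    germD Fq n (germDelta Fq n j f) + ((frob Fq).symm (indet Fq) - indet Fq) • germD Fq n f := by
  simp only [germDelta_apply, germD_apply, map_sub, germRoot_smul, germScaleT_germRoot,
    germScaleT_germScaleS, germScaleS_smul, germScaleT_smul, sub_smul, smul_sub]
  abel

theorem germDelta_comm (i j : Fin n) (f : FunGerm Fq n) :
    germDelta Fq n i (germDelta Fq n j f) = germDelta Fq n j (germDelta Fq n i f) := by
  simp only [germDelta_apply, map_sub, germScaleT_smul, germScaleT_comm Fq i j]
  abel

theorem germD_smul (c : Kc Fq) (f : FunGerm Fq n) :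
    germD Fq n (c • f) = (frob Fq).symm c • germD Fq n f := by
  rw [germD_apply, germD_apply, ← germRoot_smul, germScaleS_smul, smul_sub, smul_comm]

theorem germDelta_smul (j : Fin n) (c : Kc Fq) (f : FunGerm Fq n) :
    germDelta Fq n j (c • f) = c • germDelta Fq n j f := by
  rw [germDelta_apply, germDelta_apply, germScaleT_smul, smul_sub, smul_comm]

end Relations

/-! ### The filtration `Γ_ν` of the Carlitz ring. -/

namespace CarlitzRing

variable {Fq : Type*} [Field Fq] [Fintype Fq] {n : ℕ}

theorem ext_smul {a b : CarlitzRing Fq n}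
    (h : ∀ f : CarlitzFun Fq n,
      ((a • f : CarlitzFun Fq n) : FunGerm Fq n) = (b • f : CarlitzFun Fq n)) :
    a = b :=
  Subtype.ext (AddMonoidHom.ext fun f => Subtype.ext (h f))

theorem smul_eq_scalar_mul (c : Kc Fq) (a : CarlitzRing Fq n) : c • a = scalar Fq n c * a := rfl

instance : IsScalarTower (Kc Fq) (CarlitzRing Fq n) (CarlitzRing Fq n) where
  smul_assoc c a b := mul_assoc (scalar Fq n c) a b

variable (Fq n)

/-- The generators `τ, d_s, Δ_1, …, Δ_n`. -/
def gens : Fin (n + 2) → CarlitzRing Fq n := Fin.cons (tau Fq n) (Fin.cons (dS Fq n) (delta Fq n))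

theorem gens_succ_succ (j : Fin n) : gens Fq n j.succ.succ = delta Fq n j := rfl

theorem gens_mem (i : Fin (n + 2)) : gens Fq n i ∈ wordSpan (Kc Fq) (gens Fq n) 2 := by
  simpa using word_mem_wordSpan (K := Kc Fq) (x := gens Fq n) (w := [i]) (ν := 2) (by simp)

theorem one_mem_wordSpan {ν : ℕ} (h : 0 < ν) :
    (1 : CarlitzRing Fq n) ∈ wordSpan (Kc Fq) (gens Fq n) ν := by
  simpa using word_mem_wordSpan (K := Kc Fq) (x := gens Fq n) (w := []) (ν := ν) (by simpa)

theorem dS_mul_tau : dS Fq n * tau Fq n - tau Fq n * dS Fq n =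
    (indet Fq - (frob Fq).symm (indet Fq)) • (1 : CarlitzRing Fq n) := by
  rw [sub_eq_iff_eq_add']
  exact ext_smul fun f => germD_germTau Fq (f : FunGerm Fq n)

theorem delta_mul_tau (j : Fin n) : delta Fq n j * tau Fq n - tau Fq n * delta Fq n j =
    (frob Fq (indet Fq) - indet Fq) • tau Fq n := by
  rw [sub_eq_iff_eq_add']
  exact ext_smul fun f => germDelta_germTau Fq j f

theorem delta_mul_dS (j : Fin n) : delta Fq n j * dS Fq n - dS Fq n * delta Fq n j =
    ((frob Fq).symm (indet Fq) - indet Fq) • dS Fq n := by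
  rw [sub_eq_iff_eq_add']
  exact ext_smul fun f => germDelta_germD Fq j f

theorem delta_mul_delta (i j : Fin n) :
    delta Fq n i * delta Fq n j = delta Fq n j * delta Fq n i :=
  ext_smul fun f => germDelta_comm Fq i j f

theorem tau_mul_smul (c : Kc Fq) (a : CarlitzRing Fq n) :
    tau Fq n * c • a = frob Fq c • (tau Fq n * a) :=
  ext_smul fun f => germTau_smul Fq c ((a • f : CarlitzFun Fq n) : FunGerm Fq n)

theorem dS_mul_smul (c : Kc Fq) (a : CarlitzRing Fq n) :
    dS Fq n * c • a = (frob Fq).symm c • (dS Fq n * a) :=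
  ext_smul fun f => germD_smul Fq c ((a • f : CarlitzFun Fq n) : FunGerm Fq n)

theorem delta_mul_smul (j : Fin n) (c : Kc Fq) (a : CarlitzRing Fq n) :
    delta Fq n j * c • a = c • (delta Fq n j * a) :=
  ext_smul fun f => germDelta_smul Fq j c ((a • f : CarlitzFun Fq n) : FunGerm Fq n)

theorem quasiCommuting_gens : QuasiCommuting (Kc Fq) (gens Fq n) where
  semilinear i := by
    refine Fin.cases ⟨_, tau_mul_smul Fq n⟩ (fun i => ?_) i
    exact Fin.cases ⟨_, dS_mul_smul Fq n⟩ (fun j => ⟨_, delta_mul_smul Fq n j⟩) i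
  comm i j := by
    have h1 : dS Fq n * tau Fq n - tau Fq n * dS Fq n ∈ wordSpan (Kc Fq) (gens Fq n) 2 := by
      rw [dS_mul_tau]
      exact Submodule.smul_mem _ _ (one_mem_wordSpan Fq n two_pos)
    have h2 : ∀ j, delta Fq n j * tau Fq n - tau Fq n * delta Fq n j ∈
        wordSpan (Kc Fq) (gens Fq n) 2 := fun j => by
      rw [delta_mul_tau]
      exact Submodule.smul_mem _ _ (gens_mem Fq n 0)
    have h3 : ∀ j, delta Fq n j * dS Fq n - dS Fq n * delta Fq n j ∈
        wordSpan (Kc Fq) (gens Fq n) 2 := fun j => by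
      rw [delta_mul_dS]
      exact Submodule.smul_mem _ _ (gens_mem Fq n (Fin.succ 0))
    induction i using Fin.cases with
    | zero =>
      induction j using Fin.cases with
      | zero => simp
      | succ j =>
        rw [← neg_mem_iff, neg_sub]
        induction j using Fin.cases with
        | zero => exact h1
        | succ j => exact h2 j
    | succ i =>
      induction i using Fin.cases with
      | zero =>
        induction j using Fin.cases with
        | zero => exact h1
        | succ j =>
          induction j using Fin.cases with
          | zero => simp
          | succ j =>
            rw [← neg_mem_iff, neg_sub]
            exact h3 j
      | succ i =>
        induction j using Fin.cases with
        | zero => exact h2 i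
        | succ j =>
          induction j using Fin.cases with
          | zero => exact h3 i
          | succ j => simp [gens_succ_succ, delta_mul_delta Fq n i j]

theorem orderedMonomial_gens (l μ : ℕ) (i : Fin n → ℕ) :
    orderedMonomial (gens Fq n) (Fin.cons l (Fin.cons μ i)) =
      tau Fq n ^ l * dS Fq n ^ μ * (List.ofFn fun j => delta Fq n j ^ i j).prod := by
  rw [orderedMonomial, List.ofFn_succ, List.ofFn_succ, List.prod_cons, List.prod_cons, mul_assoc]
  rfl

/-- Ordered monomials span all words of the same length bound, which makes `Γ` multiplicative. The
shift by one reflects the strict bound in `wordSpan`. -/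
theorem Gamma_eq (ν : ℕ) : Gamma Fq n ν = wordSpan (Kc Fq) (gens Fq n) (ν + 1) := by
  rw [(quasiCommuting_gens Fq n).wordSpan_eq, Gamma]
  congr 1
  ext a
  constructor
  · rintro ⟨l, μ, i, h, rfl⟩
    refine ⟨Fin.cons l (Fin.cons μ i), ?_, orderedMonomial_gens Fq n l μ i⟩
    rw [Set.mem_ofPred_eq]
    simp only [Fin.sum_univ_succ, Fin.cons_zero, Fin.cons_succ]
    omega
  · rintro ⟨α, h, rfl⟩
    refine ⟨α 0, α 1, fun j => α j.succ.succ, ?_, ?_⟩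
    · rw [Set.mem_ofPred_eq, Fin.sum_univ_succ, Fin.sum_univ_succ] at h
      rw [add_assoc]
      exact Nat.lt_succ_iff.mp h
    · rw [← orderedMonomial_gens]
      congr 1
      funext i
      refine Fin.cases rfl (fun i => ?_) i
      exact Fin.cases rfl (fun j => rfl) i

theorem exists_mem_Gamma (φ : CarlitzRing Fq n) : ∃ ν, φ ∈ Gamma Fq n ν := by
  simp only [Gamma_eq]
  have hm : ∀ {i j : ℕ} {a : CarlitzRing Fq n}, i ≤ j →
      a ∈ wordSpan (Kc Fq) (gens Fq n) (i + 1) → a ∈ wordSpan (Kc Fq) (gens Fq n) (j + 1) :=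
    fun h ha => wordSpan_mono (by omega) ha
  obtain ⟨φ, hφ⟩ := φ
  induction hφ using Subring.closure_induction with
  | mem a ha =>
    rcases ha with ((rfl | rfl) | ⟨j, rfl⟩) | ⟨c, rfl⟩
    · exact ⟨1, gens_mem Fq n 0⟩
    · exact ⟨1, gens_mem Fq n (Fin.succ 0)⟩
    · exact ⟨1, gens_mem Fq n j.succ.succ⟩
    · have h := Submodule.smul_mem _ c (one_mem_wordSpan Fq n one_pos)
      rw [smul_eq_scalar_mul, mul_one] at h
      exact ⟨0, h⟩
  | zero => exact ⟨0, zero_mem _⟩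
  | one => exact ⟨0, one_mem_wordSpan Fq n one_pos⟩
  | add a b ha hb iha ihb =>
    obtain ⟨i, hi⟩ := iha
    obtain ⟨j, hj⟩ := ihb
    exact ⟨max i j, add_mem (hm (le_max_left i j) hi) (hm (le_max_right i j) hj)⟩
  | neg a ha ih =>
    obtain ⟨i, hi⟩ := ih
    exact ⟨i, neg_mem hi⟩
  | mul a b ha hb iha ihb =>
    obtain ⟨i, hi⟩ := iha
    obtain ⟨j, hj⟩ := ihb
    exact ⟨i + j, (quasiCommuting_gens Fq n).mul_mem hi hj⟩

theorem Gamma_mul_mem {i j : ℕ} {a b : CarlitzRing Fq n} (ha : a ∈ Gamma Fq n i)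
    (hb : b ∈ Gamma Fq n j) : a * b ∈ Gamma Fq n (i + j) := by
  rw [Gamma_eq] at *
  exact (quasiCommuting_gens Fq n).mul_mem ha hb

theorem Gamma_mono : Monotone (Gamma Fq n) := fun i j h => by
  rw [Gamma_eq, Gamma_eq]
  exact wordSpan_mono (by omega)

theorem one_mem_Gamma (ν : ℕ) : (1 : CarlitzRing Fq n) ∈ Gamma Fq n ν := by
  rw [Gamma_eq]
  exact one_mem_wordSpan Fq n ν.succ_pos

end CarlitzRing

/-! ### Uniqueness of coefficients of series in `q`-power monomials. -/

section Uniqueness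

theorem exists_ne_zero_norm_lt {K : Type*} [NormedField K] {x : K} (hx0 : x ≠ 0) (hx1 : ‖x‖ < 1) {δ : ℝ} (hδ : 0 < δ) :
    ∃ s : K, s ≠ 0 ∧ ‖s‖ < δ := by
  obtain ⟨R, hR⟩ := exists_pow_lt_of_lt_one hδ hx1
  exact ⟨x ^ R, pow_ne_zero _ hx0, by rwa [norm_pow]⟩

/-- Linear growth of the exponent gap provides the geometric majorant for dominated convergence
below. -/
theorem sub_le_pow_sub_pow (hq : 1 < q) (m₀ m : ℕ) : m - m₀ ≤ q ^ m - q ^ m₀ := by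
  rcases le_total m m₀ with h | h
  · simp [Nat.sub_eq_zero_of_le h]
  · obtain ⟨j, rfl⟩ := Nat.exists_eq_add_of_le h
    have := (pow_right_strictMono₀ hq).add_le_nat j m₀
    rw [add_comm j m₀] at this
    omega

variable {K : Type*} [NormedField K] [CompleteSpace K] {x : K} {q : ℕ}

/-- A power series in the `s ^ (q ^ m)` which vanishes near `0` has zero coefficients. -/
theorem eq_zero_of_hasSum_zero (hx0 : x ≠ 0) (hx1 : ‖x‖ < 1) (hq : 1 < q) {b : ℕ → K} {δ : ℝ}
    (hδ : 0 < δ) (h : ∀ s : K, ‖s‖ < δ → HasSum (fun m => b m * s ^ q ^ m) 0) (m₀ : ℕ) :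
    b m₀ = 0 := by
  induction m₀ using Nat.strong_induction_on with
  | _ m₀ ih =>
    obtain ⟨s, hs0, hs⟩ := exists_ne_zero_norm_lt hx0 hx1 hδ
    obtain ⟨C, hC⟩ := (h s hs).summable.tendsto_cofinite_zero.norm.bddAbove_range_of_cofinite
    have hC' : ∀ m, ‖b m * s ^ q ^ m‖ ≤ C := fun m => hC ⟨m, rfl⟩
    have hC0 : 0 ≤ C := (norm_nonneg _).trans (hC' 0)
    -- The series at `x ^ r s`, divided by `x ^ (r q ^ m₀)`. As `r → ∞` the term `m₀` stays fixed
    -- and the later ones tend to zero; the earlier ones vanish by induction, so truncated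
    -- subtraction does no harm.
    let F : ℕ → ℕ → K := fun r m => b m * s ^ q ^ m * x ^ (r * (q ^ m - q ^ m₀))
    have hF : ∀ r, HasSum (F r) 0 := fun r => by
      have hr : ‖x ^ r * s‖ < δ := by
        rw [norm_mul, norm_pow]
        exact (mul_le_of_le_one_left (norm_nonneg _) (pow_le_one₀ (norm_nonneg _) hx1.le)).trans_lt hs
      have h1 := (h _ hr).mul_left ((x ^ (r * q ^ m₀))⁻¹)
      rw [mul_zero] at h1
      refine (congrArg (fun g => HasSum g (0 : K)) (funext fun m => ?_)).mp h1
      rcases lt_or_ge m m₀ with hm | hm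
      · simp [F, ih m hm]
      · have h2 : r * q ^ m = r * (q ^ m - q ^ m₀) + r * q ^ m₀ := by
          rw [← mul_add, Nat.sub_add_cancel (Nat.pow_le_pow_right hq.le hm)]
        have h3 : x ^ (r * q ^ m₀) ≠ 0 := pow_ne_zero _ hx0
        simp only [F]
        rw [mul_pow, ← pow_mul, h2, pow_add]
        field_simp
    have hlim : ∀ m, Tendsto (fun r => F r m) atTop 
        (𝓝 ((Pi.single m₀ (b m₀ * s ^ q ^ m₀) : ℕ → K) m)) := by
      intro m
      rcases lt_trichotomy m m₀ with hm | rfl | hm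
      · simp [F, ih m hm, hm.ne]
      · simp [F]
      · have hpos : 0 < q ^ m - q ^ m₀ := Nat.sub_pos_of_lt (Nat.pow_lt_pow_right hq hm)
        have h1 : ‖x ^ (q ^ m - q ^ m₀)‖ < 1 := by
          rw [norm_pow]
          exact pow_lt_one₀ (norm_nonneg _) hx1 hpos.ne'
        have h2 := (tendsto_pow_atTop_nhds_zero_of_norm_lt_one h1).const_mul (b m * s ^ q ^ m)
        simp only [← pow_mul, mul_zero] at h2
        rw [Pi.single_eq_of_ne hm.ne']
        refine h2.congr fun r => ?_
        simp only [F, mul_comm r]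
    have hbound : Summable fun m => C * ‖x‖ ^ (m - m₀) := by
      rw [← summable_nat_add_iff m₀]
      simpa using (summable_geometric_of_lt_one (norm_nonneg x) hx1).mul_left C
    have ht := tendsto_tsum_of_dominated_convergence hbound hlim (by
      filter_upwards [eventually_ge_atTop 1] with r hr m
      simp only [F]
      rw [norm_mul, norm_pow]
      refine mul_le_mul (hC' m) ?_ (by positivity) hC0
      refine pow_le_pow_of_le_one (norm_nonneg _) hx1.le ((sub_le_pow_sub_pow hq m₀ m).trans ?_)
      exact Nat.le_mul_of_pos_left _ hr)
    rw [tsum_pi_single] at ht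
    have h0 : (fun r => ∑' m, F r m) = fun _ => 0 := funext fun r => (hF r).tsum_eq
    rw [h0] at ht
    have := tendsto_nhds_unique ht tendsto_const_nhds
    exact (mul_eq_zero.mp this).resolve_right (pow_ne_zero _ hs0)

/-- Summing first over `k` leaves a series in `s ^ (q ^ m)` alone; a fixed `s ≠ 0` shows that the
inner sums converge. -/
theorem hasSum_fiber_zero (hx0 : x ≠ 0) (hx1 : ‖x‖ < 1) (hq : 1 < q) {β : Type*} {G : ℕ × β → K}
    {δ : ℝ} (hδ : 0 < δ) (h : ∀ s : K, ‖s‖ < δ → HasSum (fun e => G e * s ^ q ^ e.1) 0) (m : ℕ) :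
    HasSum (fun k => G (m, k)) 0 := by
  obtain ⟨s, hs0, hs⟩ := exists_ne_zero_norm_lt hx0 hx1 hδ
  have hsum : ∀ m, Summable fun k => G (m, k) := fun m =>
    (summable_mul_right_iff (pow_ne_zero (q ^ m) hs0)).mp ((h s hs).summable.prod_factor m)
  have h0 := eq_zero_of_hasSum_zero (b := fun m => ∑' k, G (m, k)) hx0 hx1 hq hδ (fun s hs =>
    (h s hs).prod_fiberwise fun m => (hsum m).hasSum.mul_right (s ^ q ^ m)) m
  exact (hsum m).hasSum_iff.mpr h0

/-- The variables are peeled off one at a time. -/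
theorem eq_zero_of_hasSum_pi_zero (hx0 : x ≠ 0) (hx1 : ‖x‖ < 1) (hq : 1 < q) {δ : ℝ} (hδ : 0 < δ) :
    ∀ {N : ℕ} {a : (Fin N → ℕ) → K}, (∀ z : Fin N → K, (∀ i, ‖z i‖ < δ) →
      HasSum (fun k => a k * ∏ i, z i ^ q ^ k i) 0) → ∀ k, a k = 0
  | 0, a, h, k => by
    have := h 0 (fun i => i.elim0)
    simp only [Finset.univ_eq_empty, Finset.prod_empty, mul_one] at this
    have h1 := (hasSum_fintype a).unique this
    rw [Fintype.sum_unique] at h1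
    exact (congrArg a (Subsingleton.elim k _)).trans h1
  | N + 1, a, h, k => by
    have h1 : ∀ m (t : Fin N → K), (∀ i, ‖t i‖ < δ) →
        HasSum (fun k => a (Fin.cons m k) * ∏ i, t i ^ q ^ k i) 0 := fun m t ht => by
      refine hasSum_fiber_zero (G := fun e : ℕ × (Fin N → ℕ) =>
        a (Fin.cons e.1 e.2) * ∏ i, t i ^ q ^ e.2 i) hx0 hx1 hq hδ (fun s hs => ?_) m
      have h2 := h (Fin.cons s t) (Fin.cases hs ht)
      rw [← (Fin.consEquiv fun _ => ℕ).hasSum_iff] at h2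
      refine (congrArg (fun g => HasSum g (0 : K)) (funext fun e => ?_)).mp h2
      have h3 : Fin.consEquiv (fun _ => ℕ) e = (Fin.cons e.1 e.2 : Fin (N + 1) → ℕ) := rfl
      simp only [Function.comp_apply, h3, Fin.prod_univ_succ, Fin.cons_zero, Fin.cons_succ]
      ring
    have := eq_zero_of_hasSum_pi_zero hx0 hx1 hq hδ (h1 (k 0)) (Fin.tail k)
    rwa [Fin.cons_self_tail] at this

end Uniqueness

/-! ### Action of the generators on coefficients. -/

section Expansion

variable {Fq : Type*} [Field Fq] [Fintype Fq] {n : ℕ}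

theorem indet_ne_zero : indet Fq ≠ 0 := by
  rw [← norm_ne_zero_iff, norm_indet]
  exact inv_ne_zero (Nat.cast_ne_zero.mpr Fintype.card_ne_zero)

theorem norm_indet_lt_one : ‖indet Fq‖ < 1 := by
  rw [norm_indet]
  exact inv_lt_one_of_one_lt₀ (by exact_mod_cast Fintype.one_lt_card)

/-- Distinct powers of a number strictly between 0 and 1 differ. Hence the multipliers `x ^ (q ^ k)
- x` of `Δ_j` are pairwise distinct. -/
theorem indet_pow_injective : Function.Injective fun k : ℕ => indet Fq ^ Fintype.card Fq ^ k := by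
  intro a b h
  have h1 := congrArg norm h
  simp only [norm_pow] at h1
  exact Nat.pow_right_injective Fintype.one_lt_card (pow_right_injective₀
    (norm_pos_iff.mpr indet_ne_zero) norm_indet_lt_one.ne h1)

theorem indet_pow_succ_sub_ne_zero (m : ℕ) : indet Fq ^ Fintype.card Fq ^ (m + 1) - indet Fq ≠ 0 := by
  intro h
  have := @indet_pow_injective Fq _ _ (m + 1) 0 (by simpa using sub_eq_zero.mp h)
  omega

/-- The coefficients of an expansion of the zero germ vanish. -/
theorem IsExpansion.eq_zero {a : ℕ × (Fin n → ℕ) → Kc Fq} (ha : IsExpansion a (0 : FunGerm Fq n))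
    (e : ℕ × (Fin n → ℕ)) : a e = 0 := by
  obtain ⟨u, hu0, hu⟩ := ha.hasSum
  have hu0' : ∀ᶠ z in 𝓝 0, 0 = u z := Germ.coe_eq.mp hu0
  obtain ⟨δ, hδ, hz⟩ := Metric.eventually_nhds_iff_ball.mp (hu.and hu0')
  have key : ∀ (s : Kc Fq) (t : Fin n → Kc Fq), ‖s‖ < δ → (∀ i, ‖t i‖ < δ) →
      HasSum (fun e => a e * monomial Fq (s, t) e) 0 := fun s t hs ht => by
    have := hz (s, t) (by
      rw [mem_ball_zero_iff, Prod.norm_def, max_lt_iff]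
      exact ⟨hs, (pi_norm_lt_iff hδ).mpr ht⟩)
    rw [this.2]
    exact this.1
  obtain ⟨m, k⟩ := e
  have hq : 1 < Fintype.card Fq := Fintype.one_lt_card
  refine eq_zero_of_hasSum_pi_zero (a := fun k => a (m, k)) indet_ne_zero norm_indet_lt_one hq hδ
    (fun t ht => ?_) k
  refine hasSum_fiber_zero (G := fun e : ℕ × (Fin n → ℕ) =>
    a e * ∏ i, t i ^ Fintype.card Fq ^ e.2 i) indet_ne_zero norm_indet_lt_one hq hδ
    (fun s hs => ?_) m
  refine (congrArg (fun g => HasSum g (0 : Kc Fq)) (funext fun e => ?_)).mp (key s t hs ht)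
  simp only [monomial]
  ring

theorem IsExpansion.zero : IsExpansion 0 (0 : FunGerm Fq n) :=
  ⟨by simp, fun _ => 0, rfl, by simp⟩

theorem IsExpansion.add {a b : ℕ × (Fin n → ℕ) → Kc Fq} {f g : FunGerm Fq n}
    (ha : IsExpansion a f) (hb : IsExpansion b g) : IsExpansion (a + b) (f + g) := by
  obtain ⟨ha, u, rfl, hu⟩ := ha
  obtain ⟨hb, v, rfl, hv⟩ := hb
  refine ⟨fun e he j => ?_, u + v, rfl, ?_⟩
  · by_contra h
    have h1 : a e = 0 := by_contra fun h' => h (ha e h' j)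
    have h2 : b e = 0 := by_contra fun h' => h (hb e h' j)
    exact he (by simp [h1, h2])
  · filter_upwards [hu, hv] with z h1 h2
    simpa [add_mul] using h1.add h2

theorem IsExpansion.smul {a : ℕ × (Fin n → ℕ) → Kc Fq} {f : FunGerm Fq n} (c : Kc Fq)
    (ha : IsExpansion a f) : IsExpansion (c • a) (c • f) := by
  obtain ⟨ha, u, rfl, hu⟩ := ha
  refine ⟨fun e he j => ha e (fun h => he (by simp [h])) j, c • u, rfl, ?_⟩
  filter_upwards [hu] with z h1
  simpa [mul_assoc] using h1.mul_left c

theorem IsExpansion.sum {ι : Type*} {s : Finset ι} {a : ι → ℕ × (Fin n → ℕ) → Kc Fq}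
    {f : ι → FunGerm Fq n} (h : ∀ i ∈ s, IsExpansion (a i) (f i)) :
    IsExpansion (∑ i ∈ s, a i) (∑ i ∈ s, f i) := by
  classical
  induction s using Finset.induction_on with
  | empty => simpa using IsExpansion.zero
  | insert i s hi ih =>
    rw [Finset.sum_insert hi, Finset.sum_insert hi]
    exact (h i (Finset.mem_insert_self i s)).add
      (ih fun j hj => h j (Finset.mem_insert_of_mem hj))

/-- The coefficients of `τ f`. -/
def tauCoeff (a : ℕ × (Fin n → ℕ) → Kc Fq) : ℕ × (Fin n → ℕ) → Kc Fq :=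
  Function.extend shift (fun e => frob Fq (a e)) 0

theorem IsExpansion.tau {a : ℕ × (Fin n → ℕ) → Kc Fq} {f : FunGerm Fq n} (ha : IsExpansion a f) :
    IsExpansion (tauCoeff a) (germTau Fq n f) := by
  obtain ⟨ha, u, rfl, hu⟩ := ha
  refine ⟨fun e he j => ?_, fun z => frob Fq (u z), rfl, ?_⟩
  · by_cases h : ∃ e', shift e' = e
    · obtain ⟨e', rfl⟩ := h
      rw [tauCoeff, shift_injective.extend_apply] at he
      have := ha e' (fun h => he (by simp [h])) j
      simpa [shift] using this
    · exact absurd (Function.extend_apply' _ _ _ h) he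
  · filter_upwards [hu] with z hz
    have h1 := hz.map (frob Fq) (frob_continuous Fq)
    rw [← shift_injective.hasSum_iff (fun e he => ?_)]
    · refine (congrArg (fun g => HasSum g _) (funext fun e => ?_)).mp h1
      rw [Function.comp_apply, Function.comp_apply, tauCoeff, shift_injective.extend_apply,
        monomial_shift, map_mul]
    · rw [tauCoeff, Function.extend_apply' _ _ _ (fun h => he h)]
      simp

theorem IsExpansion.delta (j : Fin n) {a : ℕ × (Fin n → ℕ) → Kc Fq} {f : FunGerm Fq n}
    (ha : IsExpansion a f) : IsExpansion
      (fun e => (indet Fq ^ Fintype.card Fq ^ e.2 j - indet Fq) * a e) (germDelta Fq n j f) := by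
  obtain ⟨ha, u, rfl, hu⟩ := ha
  refine ⟨fun e he => ha e (fun h => he (by simp [h])),
    fun z => u (scaleT Fq j z) - indet Fq * u z, rfl, ?_⟩
  filter_upwards [hu, (tendsto_scaleT Fq j).eventually hu] with z h1 h2
  have h3 := h2.sub (h1.mul_left (indet Fq))
  refine (congrArg (fun g => HasSum g _) (funext fun e => ?_)).mp h3
  rw [monomial_scaleT]
  ring

/-- The coefficients of `d_s f`. -/
def dCoeff (a : ℕ × (Fin n → ℕ) → Kc Fq) (e : ℕ × (Fin n → ℕ)) : Kc Fq :=
  (frob Fq).symm ((indet Fq ^ Fintype.card Fq ^ (e.1 + 1) - indet Fq) * a (shift e))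

theorem IsExpansion.dS {a : ℕ × (Fin n → ℕ) → Kc Fq} {f : FunGerm Fq n} (ha : IsExpansion a f) :
    IsExpansion (dCoeff a) (germD Fq n f) := by
  obtain ⟨ha, u, rfl, hu⟩ := ha
  refine ⟨fun e he j => ?_, fun z => (frob Fq).symm (u (scaleS Fq z) - indet Fq * u z), rfl, ?_⟩
  · have := ha (shift e) (fun h => he (by simp [dCoeff, h])) j
    simpa [shift] using this
  · filter_upwards [hu, (tendsto_scaleS Fq).eventually hu] with z h1 h2
    have h3 := h2.sub (h1.mul_left (indet Fq))
    have h4 : (fun e => a e * monomial Fq (scaleS Fq z) e - indet Fq * (a e * monomial Fq z e)) =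
        fun e => (indet Fq ^ Fintype.card Fq ^ e.1 - indet Fq) * a e * monomial Fq z e := by
      funext e
      rw [monomial_scaleS]
      ring
    rw [h4] at h3
    replace h3 := h3.map (frob Fq).symm (frob_symm_continuous Fq)
    rw [← shift_injective.hasSum_iff (fun e he => ?_)] at h3
    · refine (congrArg (fun g => HasSum g _) (funext fun e => ?_)).mp h3
      simp only [Function.comp_apply, monomial_shift]
      rw [map_mul _ _ (frob Fq _), RingEquiv.symm_apply_apply]
      rfl
    · have h0 : a e = 0 ∨ e.1 = 0 := by
        by_contra! h
        refine he ⟨(e.1 - 1, fun j => e.2 j - 1), ?_⟩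
        have := ha e h.1
        refine Prod.ext ?_ (funext fun j => ?_)
        · simp only [shift]; omega
        · have := this j
          simp only [shift]; omega
      rcases h0 with h0 | h0 <;> simp [h0]

theorem shift_iterate (l : ℕ) (e : ℕ × (Fin n → ℕ)) :
    shift^[l] e = (e.1 + l, fun j => e.2 j + l) := by
  induction l with
  | zero => rfl
  | succ l ih => rw [Function.iterate_succ_apply', ih]; rfl

theorem tauCoeff_iterate_shift (l : ℕ) (a : ℕ × (Fin n → ℕ) → Kc Fq) (e : ℕ × (Fin n → ℕ)) :
    tauCoeff^[l] a (shift^[l] e) = (frob Fq)^[l] (a e) := by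
  induction l with
  | zero => rfl
  | succ l ih =>
    rw [Function.iterate_succ_apply', Function.iterate_succ_apply', Function.iterate_succ_apply',
      tauCoeff, shift_injective.extend_apply, ih]

theorem tauCoeff_iterate_eq_zero {l : ℕ} (a : ℕ × (Fin n → ℕ) → Kc Fq) {e : ℕ × (Fin n → ℕ)}
    (h : e.1 < l) : tauCoeff^[l] a e = 0 := by
  induction l generalizing e with
  | zero => omega
  | succ l ih =>
    rw [Function.iterate_succ_apply', tauCoeff]
    by_cases he : ∃ e', shift e' = e
    · obtain ⟨e', rfl⟩ := he
      rw [shift_injective.extend_apply, ih (Nat.lt_of_succ_lt_succ h), map_zero]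
    · rw [Function.extend_apply' _ _ _ he]; rfl

/-- Each `d_s` lowers all exponents by one. Its multiplier `x ^ (q ^ m) - x` vanishes only at `m =
0`, and that level is not used. -/
theorem dCoeff_iterate_ne_zero (μ : ℕ) {a : ℕ × (Fin n → ℕ) → Kc Fq} {e : ℕ × (Fin n → ℕ)}
    (h : a (shift^[μ] e) ≠ 0) : dCoeff^[μ] a e ≠ 0 := by
  induction μ generalizing e with
  | zero => exact h
  | succ μ ih =>
    rw [Function.iterate_succ_apply', dCoeff]
    rw [Function.iterate_succ_apply] at h
    exact (map_ne_zero (frob Fq).symm).mpr (mul_ne_zero (indet_pow_succ_sub_ne_zero _) (ih h))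

end Expansion

/-! ### Independence of the elements `τ ^ l Δ ^ i f`. -/

namespace CarlitzRing

variable {Fq : Type*} [Field Fq] [Fintype Fq] {n : ℕ} {a : ℕ × (Fin n → ℕ) → Kc Fq}
  {f : CarlitzFun Fq n}

theorem isExpansion_tau_pow (ha : IsExpansion a (f : FunGerm Fq n)) (l : ℕ) :
    IsExpansion (tauCoeff^[l] a) ((tau Fq n ^ l • f : CarlitzFun Fq n) : FunGerm Fq n) := by
  induction l with
  | zero => simpa using ha
  | succ l ih =>
    rw [Function.iterate_succ_apply', pow_succ', mul_smul]
    exact ih.tau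

theorem isExpansion_dS_pow (ha : IsExpansion a (f : FunGerm Fq n)) (μ : ℕ) :
    IsExpansion (dCoeff^[μ] a) ((dS Fq n ^ μ • f : CarlitzFun Fq n) : FunGerm Fq n) := by
  induction μ with
  | zero => simpa using ha
  | succ μ ih =>
    rw [Function.iterate_succ_apply', pow_succ', mul_smul]
    exact ih.dS

theorem isExpansion_delta_word (ha : IsExpansion a (f : FunGerm Fq n)) (w : List (Fin n)) :
    IsExpansion (fun e => (w.map fun j => indet Fq ^ Fintype.card Fq ^ e.2 j - indet Fq).prod * a e)
      (((w.map (delta Fq n)).prod • f : CarlitzFun Fq n) : FunGerm Fq n) := by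
  induction w with
  | nil => simpa using ha
  | cons j w ih =>
    simp only [List.map_cons, List.prod_cons, mul_smul, mul_assoc]
    exact ih.delta j

theorem isExpansion_delta (ha : IsExpansion a (f : FunGerm Fq n)) (i : Fin n → ℕ) :
    IsExpansion (fun e => (∏ j, (indet Fq ^ Fintype.card Fq ^ e.2 j - indet Fq) ^ i j) * a e)
      ((orderedMonomial (delta Fq n) i • f : CarlitzFun Fq n) : FunGerm Fq n) := by
  have := isExpansion_delta_word ha (sortedWord i)
  simp only [prod_sortedWord, orderedMonomial, List.prod_ofFn] at this
  exact this

/-- If the coefficients `a_{0,k}` do not vanish on an infinite grid, the `τ ^ l Δ ^ i f` are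
linearly independent. -/
theorem linearIndependent_tau_delta (ha : IsExpansion a (f : FunGerm Fq n))
    {S : Fin n → Set ℕ} (hS : ∀ j, (S j).Infinite)
    (hk : ∀ k : Fin n → ℕ, (∀ j, k j ∈ S j) → a (0, k) ≠ 0) :
    LinearIndependent (Kc Fq) fun p : ℕ × (Fin n → ℕ) =>
      (tau Fq n ^ p.1 * orderedMonomial (delta Fq n) p.2) • f := by
  classical
  rw [linearIndependent_iff']
  intro s c hc
  by_contra! hne
  -- The smallest power of `τ` in the relation: terms with more factors `τ` do not reach this level
  -- in `s`.
  obtain ⟨p₀, hp₀, hmin⟩ := (s.filter fun p => c p ≠ 0).exists_min_image Prod.fst (by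
    obtain ⟨p, hp, hp'⟩ := hne
    exact ⟨p, by simp [hp, hp']⟩)
  rw [Finset.mem_filter] at hp₀
  let E : ℕ × (Fin n → ℕ) → ℕ × (Fin n → ℕ) → Kc Fq := fun p => tauCoeff^[p.1]
    fun e => (∏ j, (indet Fq ^ Fintype.card Fq ^ e.2 j - indet Fq) ^ p.2 j) * a e
  have hE : IsExpansion (∑ p ∈ s, c p • E p) (0 : FunGerm Fq n) := by
    have h1 : IsExpansion (∑ p ∈ s, c p • E p) (∑ p ∈ s, c p •
        (((tau Fq n ^ p.1 * orderedMonomial (delta Fq n) p.2) • f : CarlitzFun Fq n) :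
          FunGerm Fq n)) :=
      IsExpansion.sum fun p _ => IsExpansion.smul _ (by
        rw [mul_smul]
        exact isExpansion_tau_pow (isExpansion_delta ha p.2) p.1)
    have h2 := congrArg (CarlitzFun Fq n).subtype hc
    rw [map_sum, map_zero] at h2
    rwa [← h2]
  obtain ⟨Φ, hΦ⟩ : ∃ Φ : Kc Fq →+* Kc Fq, (frob Fq)^[p₀.1] = Φ :=
    ⟨(frob Fq : Kc Fq →+* Kc Fq) ^ p₀.1, (RingHom.coe_pow _ _).symm⟩
  let y : ℕ → Kc Fq := fun k => Φ (indet Fq ^ Fintype.card Fq ^ k - indet Fq)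
  have hy : Function.Injective y := Φ.injective.comp
    ((sub_left_injective).comp indet_pow_injective)
  -- The part of the relation with the smallest power of `τ`, as a polynomial in the multipliers of
  -- the `Δ_j` twisted by that power of Frobenius.
  let P : MvPolynomial (Fin n) (Kc Fq) := ∑ p ∈ s.filter fun p => p.1 = p₀.1,
    MvPolynomial.monomial (Finsupp.equivFunOnFinite.symm p.2) (c p)
  have hP : P = 0 := by
    refine MvPolynomial.funext_set (fun j => y '' S j) (fun j => (hS j).image hy.injOn) ?_
    intro v hv
    have hv' : ∀ j, ∃ k, k ∈ S j ∧ y k = v j := fun j => hv j (Set.mem_univ j)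
    choose k hkS hkv using hv'
    obtain rfl : (fun j => y (k j)) = v := funext hkv
    -- The coefficient at this exponent is the value of `P` at the twisted multipliers, times the
    -- twist of `a (0, k) ≠ 0`.
    have h0 := hE.eq_zero (shift^[p₀.1] (0, k))
    rw [Finset.sum_apply, ← Finset.sum_filter_add_sum_filter_not s fun p => p.1 = p₀.1] at h0
    have h1 : ∑ p ∈ s.filter (fun p => ¬ p.1 = p₀.1), (c p • E p) (shift^[p₀.1] (0, k)) = 0 := by
      refine Finset.sum_eq_zero fun p hp => ?_
      rw [Finset.mem_filter] at hp
      by_cases hcp : c p = 0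
      · simp [hcp]
      · have hlt : p₀.1 < p.1 :=
          lt_of_le_of_ne (hmin p (by simp [hp.1, hcp])) (Ne.symm hp.2)
        have hE0 : E p (shift^[p₀.1] (0, k)) = 0 :=
          tauCoeff_iterate_eq_zero _ (by simpa [shift_iterate] using hlt)
        rw [Pi.smul_apply, hE0, smul_zero]
    rw [h1, add_zero] at h0
    have h2 : ∑ p ∈ s.filter (fun p => p.1 = p₀.1), (c p • E p) (shift^[p₀.1] (0, k)) =
        MvPolynomial.eval (fun j => y (k j)) P * Φ (a (0, k)) := by
      rw [map_sum, Finset.sum_mul]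
      refine Finset.sum_congr rfl fun p hp => ?_
      rw [Finset.mem_filter] at hp
      rw [Pi.smul_apply, MvPolynomial.eval_monomial, ← hp.2]
      simp only [E]
      rw [tauCoeff_iterate_shift, hp.2, hΦ, smul_eq_mul, mul_assoc]
      congr 1
      rw [map_mul, map_prod, Finsupp.prod_fintype _ _ (fun _ => pow_zero _)]
      congr 1
      refine Finset.prod_congr rfl fun j _ => ?_
      rw [map_pow]
      rfl
    rw [h2] at h0
    rw [map_zero]
    exact (mul_eq_zero.mp h0).resolve_right ((map_ne_zero Φ).mpr (hk k hkS))
  have hcoeff := congrArg (MvPolynomial.coeff (Finsupp.equivFunOnFinite.symm p₀.2)) hP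
  rw [MvPolynomial.coeff_sum, MvPolynomial.coeff_zero, Finset.sum_eq_single p₀] at hcoeff
  · simp only [MvPolynomial.coeff_monomial, if_true] at hcoeff
    exact hp₀.2 hcoeff
  · intro p hp hne
    rw [MvPolynomial.coeff_monomial, if_neg]
    intro h
    rw [Finset.mem_filter] at hp
    exact hne (Prod.ext hp.2 (Finsupp.equivFunOnFinite.symm.injective h))
  · intro h
    exact absurd (by simp [hp₀.1]) h

end CarlitzRing

/-! ### Comparison of good filtrations. -/

namespace ModFiltration

variable {Fq : Type*} [Field Fq] [Fintype Fq] {n : ℕ}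
  {M : Type*} [AddCommGroup M] [Module (CarlitzRing Fq n) M] [Module (Kc Fq) M]

/-- A good filtration is built from finitely many generators. Once the second filtration contains
these by level `c`, it contains everything with delay at most `c`. -/
theorem IsGood.exists_part_le {F : ModFiltration Fq n M} (hF : F.IsGood)
    (F' : ModFiltration Fq n M) : ∃ c, ∀ j, F.part j ≤ F'.part (j + c) := by
  obtain ⟨r, k, g, -, hg⟩ := hF
  choose d hd using fun i => F'.exhaustive (g i)
  refine ⟨∑ i, d i, fun j => ?_⟩
  induction j using Nat.strong_induction_on with
  | _ j ih =>
    refine (hg j).trans (sup_le (iSup₂_le fun j' hj' => (ih j' hj').trans (F'.mono (by omega))) ?_)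
    rw [Submodule.span_le]
    rintro _ ⟨i, -, a, ha, rfl⟩
    have hi : d i ≤ ∑ i, d i :=
      Finset.single_le_sum (f := d) (fun _ _ => Nat.zero_le _) (Finset.mem_univ i)
    exact F'.mono (by omega) (F'.smul_mem _ _ a _ ha (hd i))

theorem degree_le_of_part_le {F F' : ModFiltration Fq n M} {χ χ' : Polynomial ℚ}
    (h : F.IsHilbertPolynomial χ) (h' : F'.IsHilbertPolynomial χ') {c : ℕ}
    (hc : ∀ j, F.part j ≤ F'.part (j + c)) : χ.degree ≤ χ'.degree := by
  obtain ⟨N, hN⟩ := h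
  obtain ⟨N', hN'⟩ := h'
  have h1 : χ.degree ≤ (χ'.comp (Polynomial.X + Polynomial.C (c : ℚ))).degree := by
    refine degree_le_of_eventually_le ?_ ?_
    · filter_upwards [eventually_ge_atTop N] with s hs
      rw [← hN s hs]
      positivity
    · filter_upwards [eventually_ge_atTop (max N N')] with s hs
      have := F'.finite (s + c)
      have h2 := hN' (s + c) (by omega)
      rw [Nat.cast_add] at h2
      rw [← hN s (by omega), Polynomial.eval_comp, Polynomial.eval_add, Polynomial.eval_X,
        Polynomial.eval_C, ← h2]
      exact_mod_cast Submodule.finrank_mono (hc s)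
  -- Shifting the argument is a Taylor shift and preserves the degree.
  rwa [← Polynomial.taylor_apply, Polynomial.degree_taylor] at h1

theorem hasGKDim [IsScalarTower (Kc Fq) (CarlitzRing Fq n) M] {F : ModFiltration Fq n M} (hF : F.IsGood) {χ : Polynomial ℚ}
    (hχ : F.IsHilbertPolynomial χ) (h0 : χ ≠ 0) : HasGKDim Fq n M χ.natDegree := by
  refine ⟨⟨F, hF, χ, hχ, Polynomial.degree_eq_natDegree h0⟩, fun F' hF' χ' hχ' => ?_⟩
  obtain ⟨c, hc⟩ := hF.exists_part_le F'
  obtain ⟨c', hc'⟩ := hF'.exists_part_le F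
  rw [← Polynomial.degree_eq_natDegree h0]
  exact le_antisymm (degree_le_of_part_le hχ' hχ hc') (degree_le_of_part_le hχ hχ' hc)

end ModFiltration

/-! ### The module `M_f`: Hilbert polynomial and bounds for its degree. -/

section Cyclic

open CarlitzRing

variable {Fq : Type*} [Field Fq] [Fintype Fq] {n : ℕ} (f : CarlitzFun Fq n)

/-- The generator of `M_f`. -/
def cyclicGen : cyclicModule f := ⟨f, Submodule.mem_span_singleton_self f⟩

theorem exists_smul_cyclicGen (v : cyclicModule f) : ∃ a : CarlitzRing Fq n, a • cyclicGen f = v := by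
  obtain ⟨a, ha⟩ := Submodule.mem_span_singleton.mp v.2
  exact ⟨a, Subtype.ext ha⟩

/-- The filtration `Γ_j f` of `M_f`. -/
def orderFiltration : ModFiltration Fq n (cyclicModule f) where
  part j := (Gamma Fq n j).map (evalAt (Kc Fq) (cyclicGen f))
  mono i j h := Submodule.map_mono (Gamma_mono Fq n h)
  exhaustive v := by
    obtain ⟨a, rfl⟩ := exists_smul_cyclicGen f v
    obtain ⟨ν, hν⟩ := exists_mem_Gamma Fq n a
    exact ⟨ν, a, hν, rfl⟩
  smul_mem ν j a v ha hv := by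
    obtain ⟨b, hb, rfl⟩ := hv
    exact ⟨a * b, Gamma_mul_mem Fq n ha hb, mul_smul a b _⟩
  finite j := by
    rw [Gamma_eq]
    exact (quasiCommuting_gens Fq n).finiteDimensional_map_wordSpan _ _

theorem orderFiltration_isGood : (orderFiltration f).IsGood := by
  refine ⟨1, fun _ => 0, fun _ => cyclicGen f,
    fun _ => ⟨1, one_mem_Gamma Fq n 0, one_smul _ _⟩, fun j => le_sup_of_le_right ?_⟩
  rintro _ ⟨a, ha, rfl⟩
  exact Submodule.subset_span ⟨0, Nat.zero_le j, a, ha, rfl⟩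

theorem finrank_orderFiltration (ν : ℕ) :
    Module.finrank (Kc Fq) ((orderFiltration f).part ν) =
      degCount (normalExponents (Kc Fq) (gens Fq n) (cyclicGen f)) ν := by
  rw [← (quasiCommuting_gens Fq n).finrank_map_wordSpan, ← Gamma_eq]
  rfl

theorem exists_isHilbertPolynomial : ∃ χ, (orderFiltration f).IsHilbertPolynomial χ := by
  obtain ⟨χ, N, h⟩ := eventuallyPolynomial_degCount
    ((quasiCommuting_gens Fq n).isLowerSet_normalExponents (K := Kc Fq) (cyclicGen f))
  exact ⟨χ, N, fun s hs => by rw [finrank_orderFiltration, h s hs]⟩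

/-- One exponent `α` fails to be normal, so the lower set of normal exponents in `ℕ ^ (n + 2)`
avoids the orthant above `α` and is covered by slabs with `n + 1` free directions. -/
theorem degree_le_of_annihilated {χ : Polynomial ℚ} (hχ : (orderFiltration f).IsHilbertPolynomial χ)
    {φ : CarlitzRing Fq n} (h0 : φ ≠ 0) (hφ : φ • f = 0) : χ.degree ≤ (n + 1 : ℕ) := by
  obtain ⟨ν, hν⟩ := exists_mem_Gamma Fq n φ
  rw [Gamma_eq] at hν
  obtain ⟨α, hα⟩ := (quasiCommuting_gens Fq n).exists_notMem_normalExponents (cyclicGen f) hν h0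
    (Subtype.ext hφ)
  have hle := degCount_le_of_forall_not_le
    (D := normalExponents (Kc Fq) (gens Fq n) (cyclicGen f)) (α := α) fun β hβ hαβ =>
      hα ((quasiCommuting_gens Fq n).isLowerSet_normalExponents (cyclicGen f) hαβ hβ)
  obtain ⟨N, hN⟩ := hχ
  refine (degree_le_of_eventually_le (Q := Polynomial.C ((∑ i, α i : ℕ) : ℚ) *
    (Polynomial.X + Polynomial.C 1) ^ (n + 1)) ?_ ?_).trans
      (Polynomial.degree_le_of_natDegree_le ((Polynomial.natDegree_C_mul_le _ _).trans ?_))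
  · filter_upwards [eventually_ge_atTop N] with s hs
    rw [← hN s hs]
    positivity
  · filter_upwards [eventually_ge_atTop N] with s hs
    rw [← hN s hs, finrank_orderFiltration]
    simp only [Polynomial.eval_mul, Polynomial.eval_C, Polynomial.eval_pow, Polynomial.eval_add,
      Polynomial.eval_X]
    exact_mod_cast hle s
  · rw [Polynomial.natDegree_pow, Polynomial.natDegree_X_add_C, mul_one]

variable {f}

theorem NonSparse.exists_linearIndependent (hf : NonSparse f) :
    ∃ μ, LinearIndependent (Kc Fq) fun p : ℕ × (Fin n → ℕ) =>
      (tau Fq n ^ p.1 * orderedMonomial (delta Fq n) p.2 * dS Fq n ^ μ) • cyclicGen f := by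
  obtain ⟨a, ha, m, -, h⟩ := hf
  obtain ⟨k, hk, hlim, hne⟩ := h 0
  refine ⟨m 0, ?_⟩
  -- `d_s ^ (m 0)` lowers the exponents of the `t_j` as well, so the grid moves down by `m 0`. It
  -- stays infinite because all `k j i ≥ m 0`.
  have hinf : ∀ j, {i | i + m 0 ∈ Set.range (k j)}.Infinite := fun j => by
    have h1 : (Set.range (k j)).Infinite := Set.infinite_of_not_bddAbove fun hb =>
      (not_bddAbove_iff.mpr fun x => by
        obtain ⟨i, hi⟩ := ((hlim j).eventually_gt_atTop x).exists
        exact ⟨k j i, ⟨i, rfl⟩, hi⟩) hb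
    refine fun hfin => h1 ((hfin.image (· + m 0)).subset ?_)
    rintro _ ⟨i, rfl⟩
    exact ⟨k j i - m 0, ⟨i, by have := hk j i; omega⟩, by have := hk j i; simp only; omega⟩
  have hli := linearIndependent_tau_delta (isExpansion_dS_pow ha (m 0)) hinf fun i hi => by
    choose r hr using hi
    refine dCoeff_iterate_ne_zero _ ?_
    rw [shift_iterate, zero_add]
    simp only [← hr]
    exact hne r
  refine LinearIndependent.of_comp
    ((cyclicModule f).subtype.restrictScalars (Kc Fq) : cyclicModule f →ₗ[Kc Fq] CarlitzFun Fq n) ?_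
  convert hli using 1
  funext p
  rw [← mul_smul]
  rfl

/-- The `n + 1` exponents of `τ` and the `Δ_j` range independently over `0, …, t`, giving
independent elements of order at most `(n + 1) t + μ`. -/
theorem NonSparse.exists_pow_le_finrank (hf : NonSparse f) : ∃ μ, ∀ t,
    (t + 1) ^ (n + 1) ≤ Module.finrank (Kc Fq) ((orderFiltration f).part ((n + 1) * t + μ)) := by
  obtain ⟨μ, hμ⟩ := hf.exists_linearIndependent
  refine ⟨μ, fun t => ?_⟩
  let ι : Fin (t + 1) × (Fin n → Fin (t + 1)) → ℕ × (Fin n → ℕ) := fun p => (p.1, fun j => p.2 j)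
  have hι : Function.Injective ι := fun p p' h => by
    refine Prod.ext (Fin.ext (congrArg Prod.fst h)) (funext fun j => Fin.ext ?_)
    exact congrFun (congrArg Prod.snd h) j
  have hli := hμ.comp ι hι
  have := (orderFiltration f).finite ((n + 1) * t + μ)
  have hcard := finrank_span_eq_card hli
  rw [Fintype.card_prod, Fintype.card_fin, Fintype.card_fun, Fintype.card_fin, Fintype.card_fin,
    ← pow_succ'] at hcard
  rw [← hcard]
  refine Submodule.finrank_mono (Submodule.span_le.mpr ?_)
  rintro _ ⟨⟨l, i⟩, rfl⟩
  refine ⟨tau Fq n ^ (l : ℕ) * orderedMonomial (delta Fq n) (fun j => (i j : ℕ)) * dS Fq n ^ μ,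
    ?_, rfl⟩
  have h1 : tau Fq n ^ (l : ℕ) * orderedMonomial (delta Fq n) (fun j => (i j : ℕ)) ∈
      Gamma Fq n ((n + 1) * t) := by
    refine Submodule.subset_span ⟨l, 0, fun j => i j, ?_, by rw [pow_zero, mul_one]; rfl⟩
    have : ∑ j, (i j : ℕ) ≤ n * t := by
      simpa using Finset.sum_le_sum (s := Finset.univ) fun j _ => Nat.lt_succ_iff.mp (i j).2
    have := l.2
    simp only [add_mul]
    omega
  refine Gamma_mul_mem Fq n h1 (Submodule.subset_span ⟨0, μ, 0, by simp, ?_⟩)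
  simp [List.ofFn_const]

theorem NonSparse.le_degree (hf : NonSparse f) {χ : Polynomial ℚ}
    (hχ : (orderFiltration f).IsHilbertPolynomial χ) : ((n + 1 : ℕ) : WithBot ℕ) ≤ χ.degree := by
  obtain ⟨μ, hμ⟩ := hf.exists_pow_le_finrank
  obtain ⟨N, hN⟩ := hχ
  -- The bound is known only along `(n + 1) t + μ`, but composition with a nonconstant linear
  -- polynomial preserves the degree.
  have h1 : ((Polynomial.X + Polynomial.C 1 : Polynomial ℚ) ^ (n + 1)).degree ≤
      (χ.comp (Polynomial.C (n + 1 : ℚ) * Polynomial.X + Polynomial.C (μ : ℚ))).degree := by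
    refine degree_le_of_eventually_le (Eventually.of_forall fun s => ?_) ?_
    · simp only [Polynomial.eval_pow, Polynomial.eval_add, Polynomial.eval_X, Polynomial.eval_C]
      positivity
    · filter_upwards [eventually_ge_atTop N] with t ht
      have h2 := hN ((n + 1) * t + μ) (by nlinarith)
      push_cast at h2
      simp only [Polynomial.eval_comp, Polynomial.eval_mul, Polynomial.eval_pow,
        Polynomial.eval_add, Polynomial.eval_X, Polynomial.eval_C]
      rw [← h2]
      exact_mod_cast hμ t
  rw [Polynomial.degree_pow, Polynomial.degree_X_add_C, nsmul_one] at h1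
  have hc : χ.comp (Polynomial.C (n + 1 : ℚ) * Polynomial.X + Polynomial.C (μ : ℚ)) ≠ 0 := by
    intro h
    rw [h, Polynomial.degree_zero, le_bot_iff] at h1
    exact WithBot.coe_ne_bot h1
  have h0 : χ ≠ 0 := by
    rintro rfl
    simp at hc
  rw [Polynomial.degree_eq_natDegree hc, Polynomial.natDegree_comp, Polynomial.natDegree_linear
    (by positivity), mul_one] at h1
  rwa [Polynomial.degree_eq_natDegree h0]

end Cyclic

end Carlitz

end

theorem theorem3 {Fq : Type*} [Field Fq] [Fintype Fq] (n : ℕ) (f : Carlitz.CarlitzFun Fq n)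
    (hf : Carlitz.NonSparse f) :
    (∃ d : ℕ, Carlitz.HasGKDim Fq n (Carlitz.cyclicModule f) d ∧ n + 1 ≤ d) ∧
      ((∃ φ : Carlitz.CarlitzRing Fq n, φ ≠ 0 ∧ φ • f = 0) → Carlitz.IsQuasiHolonomic f) := by
  obtain ⟨χ, hχ⟩ := Carlitz.exists_isHilbertPolynomial f
  have hle := hf.le_degree hχ
  have h0 : χ ≠ 0 := by
    rintro rfl
    rw [Polynomial.degree_zero, le_bot_iff] at hle
    exact WithBot.coe_ne_bot hle
  have hdim := Carlitz.ModFiltration.hasGKDim (Carlitz.orderFiltration_isGood f) hχ h0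
  have hle' : n + 1 ≤ χ.natDegree := by
    rw [Polynomial.degree_eq_natDegree h0] at hle
    exact_mod_cast hle
  refine ⟨⟨_, hdim, hle'⟩, ?_⟩
  rintro ⟨φ, hφ0, hφ⟩
  have hge := Carlitz.degree_le_of_annihilated f hχ hφ0 hφ
  have heq : χ.natDegree = n + 1 := le_antisymm (Polynomial.natDegree_le_of_degree_le hge) hle'
  rw [heq] at hdim
  exact hdim
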